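/- Consider $N$ fermionic modes with creation and annihilation operators $a_j^\dagger, a_j$ ($j=1,\dots,N$) on the $2^N$-dimensional Fock space, $\{a_j,a_k\}=0$, $\{a_j,a_k^\dagger\}=\delta_{jk}I$, and the Majorana operators $c_{2j-1}=a_j+a_j^\dagger$, $c_{2j}=i(a_j-a_j^\dagger)$. A density operator $\rho$ (positive semidefinite, of trace one) is called Gaussian if $\operatorname{tr}(\rho\,c_{j_1}\cdots c_{j_m})=0$ for all odd $m$ and $j_1<\dots<j_m$, and if it satisfies Wick's formula $$i^p\operatorname{tr}(\rho\,c_{j_1}c_{j_2}\cdots c_{j_{2p}})=\operatorname{Pf}\big(M[j_1,\dots,j_{2p}]\big)\qquad\text{for all }1\le j_1<\dots<j_{2p}\le 2N,$$ where $M_{jk}=\frac i2\operatorname{tr}(\rho[c_j,c_k])$ is its covariance matrix and $M[j_1,\dots,j_{2p}]$ is the submatrix with rows and columns $j_1,\dots,j_{2p}$. Let $$\mathcal L(\rho)=-i[H,\rho]+\sum_\mu\big(2L_\mu\rho L_\mu^\dagger-\{L_\mu^\dagger L_\mu,\rho\}\big)$$ be a Liouvillian with finitely many Lindblad operators, where $H$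 is a quadratic Hamiltonian, i.e. $$H=e\,I+\sum_{j,k}h_{jk}\,a_j^\dagger a_k+\sum_{j,k}\big(s_{jk}\,a_j^\dagger a_k^\dagger+\overline{s_{jk}}\,a_k a_j\big)$$ with $e\in\mathbb R$, a Hermitian matrix $(h_{jk})$ and $s_{jk}\in\mathbb C$, and where each $L_\mu=\sum_j(\alpha_{\mu,j}a_j^\dagger+\beta_{\mu,j}a_j)$ with $\alpha_{\mu,j},\beta_{\mu,j}\in\mathbb C$ is linear in the creation and annihilation operators. Let $\rho$ be a Gaussian state. Then the time-evolved state $e^{t\mathcal L}(\rho)$ is a Gaussian state for all $t\ge 0$. -/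

import Mathlib

namespace FermionicGaussian

noncomputable section

open scoped Matrix ComplexOrder

/-- Linear operators on the Fock space of `N` fermionic modes, written as matrices in the
occupation-number basis. A basis vector is labelled by the set of occupied modes, so the space
has dimension `2 ^ N`. -/
abbrev FockOp (N : ℕ) : Type := Matrix (Finset (Fin N)) (Finset (Fin N)) ℂ

/-- The annihilation operator `a_j`. With number states
`|S⟩ = a†_{s₁} ⋯ a†_{sᵣ} |∅⟩` for `S = {s₁ < ⋯ < sᵣ}`, it maps `|T⟩` to
`(-1)^{#{k ∈ T | k < j}} |T \ {j}⟩` if `j ∈ T`, and to `0` otherwise. -/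
def annihilation {N : ℕ} (j : Fin N) : FockOp N :=
  Matrix.of fun S T =>
    if j ∈ T ∧ S = T.erase j then (-1 : ℂ) ^ (T.filter (fun k => k < j)).card else 0

/-- The creation operator `a†_j`, the adjoint of `a_j`. -/
def creation {N : ℕ} (j : Fin N) : FockOp N := (annihilation j)ᴴ

/-- The `2N` Majorana operators, numbered from `0`: the operators with index `2j` and `2j + 1` are
`a_j + a†_j` and `i (a_j - a†_j)`. -/
def majorana {N : ℕ} (k : Fin (2 * N)) : FockOp N :=
  let j : Fin N := ⟨k.val / 2, by omega⟩
  if k.val % 2 = 0 then annihilation j + creation j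
  else Complex.I • (annihilation j - creation j)

/-- A quadratic fermion Hamiltonian: a sum of on-site energies and hopping terms (coefficients
`h`, Hermitian), pair creation and annihilation terms (coefficients `s`), and a constant energy
`e`. -/
def IsQuadraticHamiltonian {N : ℕ} (H : FockOp N) : Prop :=
  ∃ (e : ℝ) (h s : Matrix (Fin N) (Fin N) ℂ), h.IsHermitian ∧
    H = (e : ℂ) • (1 : FockOp N)
      + ∑ j, ∑ k, h j k • (creation j * annihilation k)
      + ∑ j, ∑ k, (s j k • (creation j * creation k)
          + (starRingEnd ℂ) (s j k) • (annihilation k * annihilation j))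

/-- An operator that is linear in the creation and annihilation operators. -/
def IsLinearInModes {N : ℕ} (L : FockOp N) : Prop :=
  ∃ α β : Fin N → ℂ, L = ∑ j, (α j • creation j + β j • annihilation j)

/-- The Liouvillian
`ρ ↦ -i [H, ρ] + ∑_μ (2 L_μ ρ L_μ† - L_μ† L_μ ρ - ρ L_μ† L_μ)`. -/
def liouvillian {N : ℕ} {ι : Type*} [Fintype ι] (H : FockOp N) (L : ι → FockOp N) :
    FockOp N →ₗ[ℂ] FockOp N where
  toFun ρ := -Complex.I • (H * ρ - ρ * H)
    + ∑ μ, ((2 : ℂ) • (L μ * ρ * (L μ)ᴴ) - ((L μ)ᴴ * L μ * ρ + ρ * ((L μ)ᴴ * L μ)))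
  map_add' ρ σ := by
    have key : ∀ μ, (2 : ℂ) • (L μ * (ρ + σ) * (L μ)ᴴ)
          - ((L μ)ᴴ * L μ * (ρ + σ) + (ρ + σ) * ((L μ)ᴴ * L μ))
        = ((2 : ℂ) • (L μ * ρ * (L μ)ᴴ) - ((L μ)ᴴ * L μ * ρ + ρ * ((L μ)ᴴ * L μ)))
          + ((2 : ℂ) • (L μ * σ * (L μ)ᴴ) - ((L μ)ᴴ * L μ * σ + σ * ((L μ)ᴴ * L μ))) := by
      intro μ
      simp only [mul_add, add_mul, smul_add]
      abel
    simp only [key, Finset.sum_add_distrib]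
    simp only [mul_add, add_mul, smul_sub, smul_add]
    abel
  map_smul' c ρ := by
    simp only [RingHom.id_apply, smul_add, Finset.smul_sum, smul_sub, Matrix.mul_smul,
      Matrix.smul_mul, smul_comm c]

section

open scoped Matrix.Norms.L2Operator

/-- The time evolution `e^{tℒ}`: the exponential of a superoperator on the finite-dimensional
space of operators. (The norm on that space only serves to define the convergence of the
exponential series.) -/
def timeEvolution {N : ℕ} (ℒ : FockOp N →ₗ[ℂ] FockOp N) (t : ℝ) : FockOp N →L[ℂ] FockOp N :=
  NormedSpace.exp ((t : ℂ) • LinearMap.toContinuousLinearMap ℒ)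

end

/-- The Pfaffian of an antisymmetric `2p × 2p` matrix,
`(1 / (2^p p!)) ∑_σ sgn(σ) ∏_{i < p} A_{σ(2i), σ(2i+1)}`, the rows being numbered from `0`. -/
def pfaffian {p : ℕ} (A : Matrix (Fin (2 * p)) (Fin (2 * p)) ℂ) : ℂ :=
  ((2 : ℂ) ^ p * (p.factorial : ℂ))⁻¹ *
    ∑ σ : Equiv.Perm (Fin (2 * p)), ((Equiv.Perm.sign σ : ℤ) : ℂ) *
      ∏ i : Fin p, A (σ ⟨2 * i.val, by omega⟩) (σ ⟨2 * i.val + 1, by omega⟩)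

/-- A density operator. -/
def IsState {N : ℕ} (ρ : FockOp N) : Prop := ρ.PosSemidef ∧ ρ.trace = 1

/-- The moment `tr(ρ c_{j_1} c_{j_2} ⋯ c_{j_n})`, the factors being in this order. -/
def moment {N n : ℕ} (ρ : FockOp N) (j : Fin n → Fin (2 * N)) : ℂ :=
  (ρ * (List.ofFn fun i => majorana (j i)).prod).trace

/-- The covariance matrix `M_{jk} = (i/2) tr(ρ [c_j, c_k])`. -/
def covarianceMatrix {N : ℕ} (ρ : FockOp N) : Matrix (Fin (2 * N)) (Fin (2 * N)) ℂ :=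
  Matrix.of fun j k =>
    Complex.I / 2 * (ρ * (majorana j * majorana k - majorana k * majorana j)).trace

/-- A fermionic Gaussian state: a density operator that is determined by its covariance matrix
through Wick's formula. The moments of odd order vanish, and those of even order `2p` satisfy
`i^p tr(ρ c_{j_1} ⋯ c_{j_{2p}}) = Pf(M[j_1, …, j_{2p}])` for `j_1 < ⋯ < j_{2p}`. -/
structure IsGaussianState {N : ℕ} (ρ : FockOp N) : Prop where
  isState : IsState ρ
  odd : ∀ (p : ℕ) (j : Fin (2 * p + 1) → Fin (2 * N)), StrictMono j → moment ρ j = 0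
  wick : ∀ (p : ℕ) (j : Fin (2 * p) → Fin (2 * N)), StrictMono j →
    Complex.I ^ p * moment ρ j = pfaffian ((covarianceMatrix ρ).submatrix j j)

end

end FermionicGaussian

namespace FermionicGaussian

noncomputable section

open scoped Matrix ComplexOrder symmDiff

/-! Wick's formula involves moments of every order. The proof trades it for a finite family of
operator identities that the flow visibly preserves. Let g_j = ½ ∑_k tr(ρ c_j c_k) c_k, so that
{g_j, c_k} = tr(ρ c_j c_k) I, and let E_j = ρ c_j - {ρ, g_j} be the defect. An even state of trace
one is Gaussian if and only if all E_j vanish.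

If E_j = 0, tracing against an odd word contracts c_j with each letter in turn. This is the
expansion of a Pfaffian along its first row (`pfaffian_succ`), and Wick's formula follows by
induction (`wick_of_wickDefect_eq_zero`). Conversely, Wick's formula for increasing indices only
says that E_l is orthogonal to words with indices above l. The exchange relation
`trace_wickDefect_majorana_mul` reaches the remaining increasing words
(`IsGaussianState.word_mem_defectKernel`), and these span all operators (`adjoin_majorana`).

For the dynamics, L_μ and L_μ† anticommute with each c_j up to scalars, and [H, c_j] is linear.
Moving c_j through the Liouvillian therefore flips the sign of the jump terms and leaves remainders
of the form ρx + {ρ, z} with x, z linear. The derivative of E_j becomes ℒ'(E_j) + ∑_k X_jk E_k + {ρ,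
u}, with ℒ' the twisted Liouvillian and u linear. Since E_j is orthogonal to linear operators for
any ρ of trace one, u must vanish, and no equation of motion for the covariance matrix is needed
(`exists_wickDefectVariation_eq`). As X does not depend on ρ, the defects solve a homogeneous linear
differential equation, and zero stays zero.

Trace and parity are conserved. Positivity comes from writing the evolution as a limit of
exponentials of positive maps, up to positive scalars (`posSemidef_timeEvolution`). -/

/-! ### Majorana operators: matrix elements, anticommutation relations, parity -/

/-- The Jordan–Wigner sign of mode `j` in the occupation state `T`. -/
def jwSign {N : ℕ} (j : Fin N) (T : Finset (Fin N)) : ℂ :=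
  (-1 : ℂ) ^ (T.filter (fun k => k < j)).card

lemma jwSign_mul_self {N : ℕ} (j : Fin N) (T : Finset (Fin N)) : jwSign j T * jwSign j T = 1 := by
  unfold jwSign
  rw [← mul_pow]; simp

lemma jwSign_insert {N : ℕ} (j k : Fin N) (T : Finset (Fin N)) (hk : k ∉ T) :
    jwSign j (insert k T) = if k < j then - jwSign j T else jwSign j T := by
  unfold jwSign
  rw [Finset.filter_insert]
  split_ifs with h
  · rw [Finset.card_insert_of_notMem (by simp [hk]), pow_succ]; simp
  · rfl

lemma symmDiff_singleton_of_mem {N : ℕ} {k : Fin N} {T : Finset (Fin N)} (hk : k ∈ T) :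
    T ∆ {k} = T.erase k := by
  ext x; simp only [Finset.mem_symmDiff, Finset.mem_singleton, Finset.mem_erase]; grind

lemma symmDiff_singleton_of_notMem {N : ℕ} {k : Fin N} {T : Finset (Fin N)} (hk : k ∉ T) :
    T ∆ {k} = insert k T := by
  ext x; simp only [Finset.mem_symmDiff, Finset.mem_singleton, Finset.mem_insert]; grind

lemma jwSign_symmDiff {N : ℕ} (j k : Fin N) (T : Finset (Fin N)) :
    jwSign j (T ∆ {k}) = if k < j then - jwSign j T else jwSign j T := by
  by_cases hk : k ∈ T
  · have h := jwSign_insert j k (T.erase k) (by simp)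
    rw [Finset.insert_erase hk] at h
    rw [symmDiff_singleton_of_mem hk, h]
    split_ifs <;> simp
  · rw [symmDiff_singleton_of_notMem hk, jwSign_insert _ _ _ hk]

lemma annihilation_apply {N : ℕ} (j : Fin N) (S T : Finset (Fin N)) :
    annihilation j S T = if S = T ∆ {j} then (if j ∈ T then jwSign j T else 0) else 0 := by
  simp only [annihilation, Matrix.of_apply]
  by_cases h : j ∈ T
  · simp [h, symmDiff_singleton_of_mem h, jwSign]
  · simp [h]

lemma creation_apply {N : ℕ} (j : Fin N) (S T : Finset (Fin N)) :
    creation j S T = if S = T ∆ {j} then (if j ∈ T then 0 else jwSign j T) else 0 := by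
  simp only [creation, Matrix.conjTranspose_apply, annihilation_apply]
  have hst : T = S ∆ {j} ↔ S = T ∆ {j} := by
    constructor <;> rintro rfl <;> simp
  simp only [hst]
  split_ifs with h1 h2 h3 h3
  · exfalso; subst h1; simp [Finset.mem_symmDiff, h3] at h2
  · subst h1
    rw [jwSign_symmDiff]
    simp [jwSign]
  · simp
  · exfalso; subst h1; simp [Finset.mem_symmDiff, h3] at h2
  · simp

/-- The mode to which a Majorana operator belongs. -/
def modeOf {N : ℕ} (k : Fin (2 * N)) : Fin N := ⟨k.val / 2, by omega⟩

/-- The nonzero matrix element in column `T` of a Majorana operator. -/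
def majoranaCoeff {N : ℕ} (k : Fin (2 * N)) (T : Finset (Fin N)) : ℂ :=
  jwSign (modeOf k) T *
    if k.val % 2 = 0 then 1 else if modeOf k ∈ T then Complex.I else -Complex.I

/-- A Majorana operator flips the occupation of its mode in either direction, so it has one nonzero
entry per column. Products then reduce to products of coefficients. -/
lemma majorana_apply {N : ℕ} (k : Fin (2 * N)) (S T : Finset (Fin N)) :
    majorana k S T = if S = T ∆ {modeOf k} then majoranaCoeff k T else 0 := by
  unfold majorana majoranaCoeff
  change (if k.val % 2 = 0 then annihilation (modeOf k) + creation (modeOf k)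
    else Complex.I • (annihilation (modeOf k) - creation (modeOf k))) S T = _
  by_cases h : k.val % 2 = 0
  · simp only [h, if_true, Matrix.add_apply, annihilation_apply, creation_apply]
    split_ifs <;> simp
  · simp only [h, if_false, Matrix.smul_apply, Matrix.sub_apply, annihilation_apply,
      creation_apply, smul_eq_mul]
    split_ifs <;> simp [mul_comm]

lemma majorana_mul_apply {N : ℕ} (k : Fin (2 * N)) (x : FockOp N) (S T : Finset (Fin N)) :
    (x * majorana k) S T = x S (T ∆ {modeOf k}) * majoranaCoeff k T := by
  simp [Matrix.mul_apply, majorana_apply]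

/-- The first sign comes from the Jordan–Wigner string, which sees flips of earlier modes; the
second from the ±i of a second Majorana operator, which sees a flip of its own mode. -/
lemma majoranaCoeff_symmDiff {N : ℕ} (k l : Fin (2 * N)) (T : Finset (Fin N)) :
    majoranaCoeff k (T ∆ {modeOf l}) = (if modeOf l < modeOf k then -1 else 1) *
      (if modeOf k = modeOf l ∧ k.val % 2 = 1 then -1 else 1) * majoranaCoeff k T := by
  unfold majoranaCoeff
  rw [jwSign_symmDiff]
  simp only [Finset.mem_symmDiff, Finset.mem_singleton]
  have h2 : k.val % 2 = 0 ∨ k.val % 2 = 1 := by omega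
  rcases h2 with h2 | h2 <;> by_cases h3 : modeOf k = modeOf l <;> by_cases h4 : modeOf k ∈ T <;>
    by_cases h5 : modeOf l < modeOf k <;> simp_all

/-- The canonical anticommutation relations of the Majorana operators. -/
lemma majorana_anticomm {N : ℕ} (k l : Fin (2 * N)) :
    majorana k * majorana l + majorana l * majorana k =
      (if k = l then (2 : ℂ) else 0) • (1 : FockOp N) := by
  ext S T
  simp only [Matrix.add_apply, majorana_mul_apply, majorana_apply, Matrix.smul_apply,
    majoranaCoeff_symmDiff]
  have hkl : k = l ↔ modeOf k = modeOf l ∧ k.val % 2 = l.val % 2 := by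
    simp only [modeOf, Fin.ext_iff]; omega
  have hcomm : T ∆ {modeOf k} ∆ {modeOf l} = T ∆ {modeOf l} ∆ {modeOf k} := by
    rw [symmDiff_assoc, symmDiff_comm {modeOf k}, ← symmDiff_assoc]
  rw [hcomm]
  -- In the same mode the two flips cancel and the products are diagonal. In different modes exactly
  -- one of the two strings sees the other flip, so the two orders differ by a sign.
  by_cases hm : modeOf k = modeOf l
  · rw [hm, symmDiff_symmDiff_cancel_right]
    by_cases hST : S = T
    · subst hST
      by_cases he : k.val % 2 = l.val % 2
      · have : k = l := hkl.2 ⟨hm, he⟩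
        subst this
        have hj := jwSign_mul_self (modeOf k) S
        have h2 : k.val % 2 = 0 ∨ k.val % 2 = 1 := by omega
        rcases h2 with h2 | h2
        · by_cases h4 : modeOf k ∈ S <;> simp [majoranaCoeff, h2] <;> linear_combination 2 * hj
        · by_cases h4 : modeOf k ∈ S <;> simp [majoranaCoeff, h2, h4] <;>
            linear_combination 2 * hj
              - 2 * jwSign (modeOf k) S * jwSign (modeOf k) S * Complex.I_mul_I
      · have hne : k ≠ l := fun h => he (by rw [h])
        have h2 : (k.val % 2 = 0 ∧ l.val % 2 = 1) ∨ (k.val % 2 = 1 ∧ l.val % 2 = 0) := by omega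
        rcases h2 with ⟨h2, h3⟩ | ⟨h2, h3⟩ <;> simp [hne, h2, h3] <;> ring
    · simp [hST]
  · have hne : k ≠ l := fun h => hm (by rw [h])
    rcases lt_or_gt_of_ne hm with h | h <;>
      simp [hne, h, not_lt_of_gt h, hm, Ne.symm hm] <;> split_ifs <;> ring

lemma majorana_mul_self {N : ℕ} (k : Fin (2 * N)) : majorana k * majorana k = (1 : FockOp N) := by
  have h := majorana_anticomm k k
  rw [if_pos rfl, ← two_smul ℂ] at h
  exact smul_right_injective _ (two_ne_zero) h

lemma conjTranspose_majorana {N : ℕ} (k : Fin (2 * N)) :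
    (majorana k : FockOp N)ᴴ = majorana k := by
  unfold majorana creation
  simp only
  split_ifs
  · simp [add_comm]
  · simp only [Matrix.conjTranspose_smul, Matrix.conjTranspose_sub,
      Matrix.conjTranspose_conjTranspose, Complex.star_def, Complex.conj_I, neg_smul, smul_sub]
    abel

/-- The fermion parity operator. -/
def parity (N : ℕ) : FockOp N := Matrix.diagonal fun S => (-1 : ℂ) ^ S.card

lemma parity_mul_parity (N : ℕ) : parity N * parity N = 1 := by
  simp [parity, Matrix.diagonal_mul_diagonal, ← mul_pow]

lemma parity_mul_majorana {N : ℕ} (k : Fin (2 * N)) :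
    parity N * majorana k = -(majorana k * parity N) := by
  ext S T
  simp only [parity, Matrix.diagonal_mul, Matrix.neg_apply, Matrix.mul_diagonal, majorana_apply]
  split_ifs with h
  · subst h
    by_cases hk : modeOf k ∈ T
    · rw [symmDiff_singleton_of_mem hk]
      have : (T.erase (modeOf k)).card + 1 = T.card := Finset.card_erase_add_one hk
      rw [← this, pow_succ]; ring
    · rw [symmDiff_singleton_of_notMem hk, Finset.card_insert_of_notMem hk, pow_succ]; ring
  · simp

lemma parity_conj_majorana {N : ℕ} (k : Fin (2 * N)) :
    parity N * majorana k * parity N = -majorana k := by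
  rw [parity_mul_majorana, neg_mul, mul_assoc, parity_mul_parity, mul_one]

/-- The index of the first Majorana operator of a mode. -/
def evenIndex {N : ℕ} (j : Fin N) : Fin (2 * N) := ⟨2 * j.val, by omega⟩

/-- The index of the second Majorana operator of a mode. -/
def oddIndex {N : ℕ} (j : Fin N) : Fin (2 * N) := ⟨2 * j.val + 1, by omega⟩

lemma majorana_evenIndex {N : ℕ} (j : Fin N) :
    majorana (evenIndex j) = annihilation j + creation j := by
  have h : (⟨(2 * j.val) / 2, by omega⟩ : Fin N) = j := by ext; simp
  simp [majorana, evenIndex]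

lemma majorana_oddIndex {N : ℕ} (j : Fin N) :
    majorana (oddIndex j) = Complex.I • (annihilation j - creation j) := by
  have h : (⟨(2 * j.val + 1) / 2, by omega⟩ : Fin N) = j := by ext; simp; omega
  simp [majorana, oddIndex, h]

lemma annihilation_eq {N : ℕ} (j : Fin N) : annihilation j =
    (1 / 2 : ℂ) • majorana (evenIndex j) - (Complex.I / 2) • majorana (oddIndex j) := by
  rw [majorana_evenIndex, majorana_oddIndex, smul_smul]
  have : Complex.I / 2 * Complex.I = -(1 / 2) := by
    linear_combination (1 / 2) * Complex.I_mul_I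
  rw [this]
  module

lemma creation_eq {N : ℕ} (j : Fin N) : creation j =
    (1 / 2 : ℂ) • majorana (evenIndex j) + (Complex.I / 2) • majorana (oddIndex j) := by
  rw [majorana_evenIndex, majorana_oddIndex, smul_smul]
  have : Complex.I / 2 * Complex.I = -(1 / 2) := by
    linear_combination (1 / 2) * Complex.I_mul_I
  rw [this]
  module

/-! ### Ordered Majorana words span all operators -/

/-- The product of a list of Majorana operators. -/
def listWord {N : ℕ} (l : List (Fin (2 * N))) : FockOp N := (l.map majorana).prod

lemma listWord_cons {N : ℕ} (k : Fin (2 * N)) (l : List (Fin (2 * N))) :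
    (listWord (k :: l) : FockOp N) = majorana k * listWord l := by simp [listWord]

/-- The span of the products of Majorana operators with increasing indices that satisfy `P`. -/
def sortedSpan {N : ℕ} (P : Fin (2 * N) → Prop) : Submodule ℂ (FockOp N) :=
  Submodule.span ℂ {w | ∃ l : List (Fin (2 * N)), l.Pairwise (· < ·) ∧ (∀ a ∈ l, P a) ∧
    w = listWord l}

lemma listWord_mem_sortedSpan {N : ℕ} {P : Fin (2 * N) → Prop} {l : List (Fin (2 * N))}
    (hl : l.Pairwise (· < ·)) (hP : ∀ a ∈ l, P a) : listWord l ∈ sortedSpan P :=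
  Submodule.subset_span ⟨l, hl, hP, rfl⟩

lemma majorana_mul_mem_of_lt {N : ℕ} {P : Fin (2 * N) → Prop} {h : Fin (2 * N)} (hh : P h)
    {x : FockOp N} (hx : x ∈ sortedSpan fun a => h < a ∧ P a) :
    majorana h * x ∈ sortedSpan P := by
  induction hx using Submodule.span_induction with
  | mem x hx =>
    obtain ⟨l, hl, hP, rfl⟩ := hx
    rw [← listWord_cons]
    refine listWord_mem_sortedSpan (List.pairwise_cons.2 ⟨fun a ha => (hP a ha).1, hl⟩) ?_
    intro a ha
    rcases List.mem_cons.1 ha with rfl | ha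
    · exact hh
    · exact (hP a ha).2
  | zero => simp
  | add x y _ _ hx hy => rw [mul_add]; exact add_mem hx hy
  | smul c x _ hx => rw [mul_smul_comm]; exact Submodule.smul_mem _ _ hx

/-- Insertion sort: a smaller index goes in front, an equal one cancels, a larger one is
anticommuted past the head. `P` is generalised so that the induction can record that all letters
after the head exceed it. -/
lemma majorana_mul_listWord_mem {N : ℕ} (l : List (Fin (2 * N))) :
    ∀ (P : Fin (2 * N) → Prop) (k : Fin (2 * N)), l.Pairwise (· < ·) → (∀ a ∈ l, P a) → P k →
      majorana k * listWord l ∈ sortedSpan P := by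
  induction l with
  | nil =>
    intro P k _ _ hk
    rw [← listWord_cons]
    exact listWord_mem_sortedSpan (by simp) (by simpa using hk)
  | cons h l ih =>
    intro P k hl hP hk
    have hl' := List.pairwise_cons.1 hl
    have hPh : P h := hP h (by simp)
    have hPl : ∀ a ∈ l, P a := fun a ha => hP a (by simp [ha])
    rcases lt_trichotomy k h with hkh | rfl | hkh
    · rw [← listWord_cons]
      refine listWord_mem_sortedSpan (List.pairwise_cons.2 ⟨?_, hl⟩) ?_
      · intro a ha
        rcases List.mem_cons.1 ha with rfl | ha
        · exact hkh
        · exact hkh.trans (hl'.1 a ha)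
      · intro a ha
        rcases List.mem_cons.1 ha with rfl | ha
        · exact hk
        · exact hP a ha
    · rw [listWord_cons, ← mul_assoc, majorana_mul_self, one_mul]
      exact listWord_mem_sortedSpan hl'.2 hPl
    · have hanti := majorana_anticomm k h
      rw [if_neg (ne_of_gt hkh), zero_smul] at hanti
      rw [listWord_cons, ← mul_assoc, eq_neg_of_add_eq_zero_left hanti, neg_mul, mul_assoc]
      refine neg_mem (majorana_mul_mem_of_lt hPh ?_)
      exact ih _ k hl'.2 (fun a ha => ⟨hl'.1 a ha, hPl a ha⟩) ⟨hkh, hk⟩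

/-- The span contains 1, the empty word, and is stable under left multiplication by the generators,
hence by the whole algebra. -/
lemma adjoin_majorana_le_sortedSpan {N : ℕ} {x : FockOp N}
    (hx : x ∈ Algebra.adjoin ℂ (Set.range (majorana : Fin (2 * N) → FockOp N))) :
    x ∈ sortedSpan fun _ : Fin (2 * N) => True := by
  have key : ∀ y ∈ sortedSpan (fun _ : Fin (2 * N) => True),
      x * y ∈ sortedSpan fun _ : Fin (2 * N) => True := by
    induction hx using Algebra.adjoin_induction with
    | mem x hx =>
      obtain ⟨k, rfl⟩ := hx
      intro y hy
      induction hy using Submodule.span_induction with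
      | mem y hy =>
        obtain ⟨l, hl, hP, rfl⟩ := hy
        exact majorana_mul_listWord_mem l _ k hl hP trivial
      | zero => simp
      | add x y _ _ hx hy => rw [mul_add]; exact add_mem hx hy
      | smul c x _ hx => rw [mul_smul_comm]; exact Submodule.smul_mem _ _ hx
    | algebraMap r =>
      intro y hy
      rw [← Algebra.smul_def]
      exact Submodule.smul_mem _ _ hy
    | add a b _ _ ha hb =>
      intro y hy
      rw [add_mul]
      exact add_mem (ha y hy) (hb y hy)
    | mul a b _ _ ha hb =>
      intro y hy
      rw [mul_assoc]
      exact ha _ (hb y hy)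
  have h1 := key 1 (listWord_mem_sortedSpan (l := []) (by simp) (by simp))
  rwa [mul_one] at h1

/-- The Majorana operators generate the algebra of all operators. -/
lemma adjoin_majorana (N : ℕ) :
    Algebra.adjoin ℂ (Set.range (majorana : Fin (2 * N) → FockOp N)) = ⊤ := by
  set 𝒜 := Algebra.adjoin ℂ (Set.range (majorana : Fin (2 * N) → FockOp N))
  have hc : ∀ k, majorana k ∈ 𝒜 := fun k => Algebra.subset_adjoin ⟨k, rfl⟩
  have ha : ∀ j : Fin N, annihilation j ∈ 𝒜 := fun j => by
    rw [annihilation_eq]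
    exact sub_mem (Subalgebra.smul_mem _ (hc _) _) (Subalgebra.smul_mem _ (hc _) _)
  have ha' : ∀ j : Fin N, creation j ∈ 𝒜 := fun j => by
    rw [creation_eq]
    exact add_mem (Subalgebra.smul_mem _ (hc _) _) (Subalgebra.smul_mem _ (hc _) _)
  have hcs : ∀ (j : Fin N) (S T : Finset (Fin N)), j ∉ S →
      creation j * Matrix.single S T (1 : ℂ) =
        jwSign j S • Matrix.single (insert j S) T 1 := by
    intro j S T hj
    ext U V
    simp only [Matrix.mul_apply, Matrix.single_apply, Matrix.smul_apply, creation_apply]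
    rw [Finset.sum_eq_single S (by intro b _ hb; simp [hb.symm]) (by simp)]
    rw [symmDiff_singleton_of_notMem hj]
    by_cases h1 : U = insert j S <;> by_cases h2 : T = V <;> simp [h1, h2, hj, eq_comm]
  have hsa : ∀ (j : Fin N) (S T : Finset (Fin N)), j ∉ T →
      Matrix.single S T (1 : ℂ) * annihilation j =
        jwSign j T • Matrix.single S (insert j T) 1 := by
    intro j S T hj
    have h := congrArg Matrix.conjTranspose (hcs j T S hj)
    simpa [creation, jwSign] using h
  -- With n_j = a_j† a_j, the projection onto the state S is the product of n_j over j ∈ S and 1 -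
  -- n_j over j ∉ S. The product is formed among functions, in the subalgebra of those whose
  -- diagonal matrix lies in 𝒜.
  have hdiag : ∀ S : Finset (Fin N), Matrix.single S S (1 : ℂ) ∈ 𝒜 := by
    intro S
    let 𝒟 : Subalgebra ℂ (Finset (Fin N) → ℂ) := 𝒜.comap (Matrix.diagonalAlgHom ℂ)
    have hn : ∀ j : Fin N, (fun T : Finset (Fin N) => if j ∈ T then (1 : ℂ) else 0) ∈ 𝒟 := by
      intro j
      change Matrix.diagonal _ ∈ 𝒜
      convert mul_mem (ha' j) (ha j) using 1
      ext U V
      simp only [Matrix.mul_apply, creation_apply, annihilation_apply, Matrix.diagonal_apply]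
      rw [Finset.sum_eq_single (V ∆ {j}) (by intro b _ hb; simp [hb]) (by simp)]
      by_cases hUV : U = V
      · subst hUV
        by_cases hj : j ∈ U
        · simp [hj, Finset.mem_symmDiff, jwSign_symmDiff, jwSign_mul_self]
        · simp [hj]
      · simp [hUV]
    have hprod : (∏ j : Fin N, if j ∈ S then
        (fun T : Finset (Fin N) => if j ∈ T then (1 : ℂ) else 0) else
        1 - (fun T : Finset (Fin N) => if j ∈ T then (1 : ℂ) else 0)) ∈ 𝒟 := by
      refine prod_mem fun j _ => ?_
      split_ifs
      · exact hn j
      · exact sub_mem (one_mem _) (hn j)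
    have : Matrix.diagonal (∏ j : Fin N, if j ∈ S then
        (fun T : Finset (Fin N) => if j ∈ T then (1 : ℂ) else 0) else
        1 - (fun T : Finset (Fin N) => if j ∈ T then (1 : ℂ) else 0)) ∈ 𝒜 := hprod
    convert this using 1
    rw [← Matrix.diagonal_single]
    congr 1
    ext T
    rw [Finset.prod_apply]
    by_cases hST : T = S
    · subst hST
      rw [Pi.single_eq_same, Finset.prod_eq_one]
      intro j _
      by_cases hj : j ∈ T <;> simp [hj]
    · rw [Pi.single_eq_of_ne hST]
      obtain ⟨j, hj⟩ : ∃ j, ¬(j ∈ T ↔ j ∈ S) := by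
        by_contra! h
        exact hST (Finset.ext h)
      refine (Finset.prod_eq_zero (Finset.mem_univ j) ?_).symm
      by_cases h1 : j ∈ T <;> by_cases h2 : j ∈ S <;> simp_all
  -- From the vacuum projection, creation operators on the left fill the row label and annihilation
  -- operators on the right fill the column label.
  have hcol : ∀ S : Finset (Fin N), Matrix.single S ∅ (1 : ℂ) ∈ 𝒜 := by
    intro S
    induction S using Finset.induction_on with
    | empty => exact hdiag ∅
    | insert j S hj ih =>
      have h := Subalgebra.smul_mem _ (mul_mem (ha' j) ih) (jwSign j S)
      rwa [hcs _ _ _ hj, smul_smul, jwSign_mul_self, one_smul] at h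
  have hrow : ∀ S : Finset (Fin N), Matrix.single ∅ S (1 : ℂ) ∈ 𝒜 := by
    intro S
    induction S using Finset.induction_on with
    | empty => exact hdiag ∅
    | insert j S hj ih =>
      have h := Subalgebra.smul_mem _ (mul_mem ih (ha j)) (jwSign j S)
      rwa [hsa _ _ _ hj, smul_smul, jwSign_mul_self, one_smul] at h
  rw [eq_top_iff]
  intro x _
  rw [Matrix.matrix_eq_sum_single x]
  refine sum_mem fun S _ => sum_mem fun T _ => ?_
  have h := Subalgebra.smul_mem _ (mul_mem (hcol S) (hrow T)) (x S T)
  simpa [Matrix.single_mul_single_same, Matrix.smul_single] using h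

/-- An operator is determined by its moments with increasing indices. -/
lemma eq_zero_of_trace_mul_listWord {N : ℕ} {x : FockOp N}
    (h : ∀ l : List (Fin (2 * N)), l.Pairwise (· < ·) → (x * listWord l).trace = 0) : x = 0 := by
  have hall : ∀ y : FockOp N, (x * y).trace = 0 := by
    intro y
    have hy : y ∈ sortedSpan fun _ : Fin (2 * N) => True :=
      adjoin_majorana_le_sortedSpan (by rw [adjoin_majorana]; trivial)
    induction hy using Submodule.span_induction with
    | mem y hy =>
      obtain ⟨l, hl, -, rfl⟩ := hy
      exact h l hl
    | zero => simp
    | add a b _ _ ha hb => rw [mul_add, Matrix.trace_add, ha, hb, add_zero]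
    | smul c a _ ha => rw [mul_smul_comm, Matrix.trace_smul, ha, smul_zero]
  ext S T
  have h1 := hall (Matrix.single T S 1)
  simpa [Matrix.trace_mul_single] using h1

/-! ### Words indexed by tuples, and linear operators -/

/-- The product of a tuple of Majorana operators. -/
def word {N n : ℕ} (j : Fin n → Fin (2 * N)) : FockOp N :=
  (List.ofFn fun i => majorana (j i)).prod

lemma moment_eq {N n : ℕ} (ρ : FockOp N) (j : Fin n → Fin (2 * N)) :
    moment ρ j = (ρ * word j).trace := rfl

lemma listWord_ofFn {N n : ℕ} (j : Fin n → Fin (2 * N)) : listWord (List.ofFn j) = word j := by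
  simp [listWord, word, List.map_ofFn, Function.comp_def]

lemma word_succ {N n : ℕ} (j : Fin (n + 1) → Fin (2 * N)) :
    (word j : FockOp N) = majorana (j 0) * word (fun i => j i.succ) := by
  simp [word, List.ofFn_succ]

lemma word_cons {N n : ℕ} (k : Fin (2 * N)) (j : Fin n → Fin (2 * N)) :
    (word (Fin.cons k j : Fin (n + 1) → Fin (2 * N)) : FockOp N) = majorana k * word j := by
  simp [word_succ]

lemma word_zero {N : ℕ} (j : Fin 0 → Fin (2 * N)) : (word j : FockOp N) = 1 := by simp [word]

lemma parity_conj_word {N n : ℕ} (j : Fin n → Fin (2 * N)) :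
    parity N * word j * parity N = (-1 : ℂ) ^ n • word j := by
  induction n with
  | zero => simp [word_zero, parity_mul_parity]
  | succ n ih =>
    rw [word_succ, ← mul_assoc, parity_mul_majorana, neg_mul, mul_assoc (majorana _), neg_mul,
      mul_assoc, ih, mul_smul_comm, pow_succ, mul_neg_one, neg_smul]

/-- Moving a Majorana operator through a product of Majorana operators. -/
lemma majorana_mul_word {N n : ℕ} (k : Fin (2 * N)) (j : Fin (n + 1) → Fin (2 * N)) :
    majorana k * word j - (-1 : ℂ) ^ (n + 1) • (word j * majorana k) =
      ∑ m : Fin (n + 1), ((-1 : ℂ) ^ (m : ℕ) * if k = j m then 2 else 0) •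
        word (fun i => j (m.succAbove i)) := by
  induction n with
  | zero =>
    have h := majorana_anticomm k (j 0)
    simp [word_succ, word_zero, h]
  | succ n ih =>
    have h := majorana_anticomm k (j 0)
    have ih' := ih (fun i => j i.succ)
    rw [Fin.sum_univ_succ]
    have hs : ∀ m : Fin (n + 1), (word (fun i => j (m.succ.succAbove i)) : FockOp N) =
        majorana (j 0) * word (fun i => j (m.succAbove i).succ) := by
      intro m
      rw [word_succ]
      simp
    simp only [hs, Fin.succAbove_zero, Fin.val_zero, pow_zero, one_mul, Fin.val_succ]
    have hr : ∑ m : Fin (n + 1), ((-1 : ℂ) ^ ((m : ℕ) + 1) * if k = j m.succ then 2 else 0) •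
        (majorana (j 0) * word (fun i => j (m.succAbove i).succ)) =
        - (majorana (j 0) * (majorana k * word (fun i => j i.succ) -
          (-1 : ℂ) ^ (n + 1) • (word (fun i => j i.succ) * majorana k))) := by
      rw [ih', Finset.mul_sum, ← Finset.sum_neg_distrib]
      refine Finset.sum_congr rfl fun m _ => ?_
      rw [pow_succ, mul_smul_comm, ← neg_smul]
      congr 1
      ring
    rw [hr, word_succ j, ← mul_assoc, eq_sub_of_add_eq h, pow_succ _ (n + 1)]
    simp only [sub_mul, mul_sub, smul_mul_assoc, one_mul, mul_assoc, mul_smul_comm]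
    module

/-- The linear span of the Majorana operators. -/
def linearSpan (N : ℕ) : Submodule ℂ (FockOp N) := Submodule.span ℂ (Set.range majorana)

lemma exists_coeff_of_mem_linearSpan {N : ℕ} {x : FockOp N} (hx : x ∈ linearSpan N) :
    ∃ v : Fin (2 * N) → ℂ, x = ∑ k, v k • majorana k := by
  obtain ⟨v, hv⟩ := (Submodule.mem_span_range_iff_exists_fun ℂ).1 hx
  exact ⟨v, hv.symm⟩

lemma majorana_mem_linearSpan {N : ℕ} (k : Fin (2 * N)) : majorana k ∈ linearSpan N :=
  Submodule.subset_span ⟨k, rfl⟩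

lemma annihilation_mem_linearSpan {N : ℕ} (j : Fin N) : annihilation j ∈ linearSpan N := by
  rw [annihilation_eq]
  exact sub_mem (Submodule.smul_mem _ _ (majorana_mem_linearSpan _))
    (Submodule.smul_mem _ _ (majorana_mem_linearSpan _))

lemma creation_mem_linearSpan {N : ℕ} (j : Fin N) : creation j ∈ linearSpan N := by
  rw [creation_eq]
  exact add_mem (Submodule.smul_mem _ _ (majorana_mem_linearSpan _))
    (Submodule.smul_mem _ _ (majorana_mem_linearSpan _))

lemma conjTranspose_mem_linearSpan {N : ℕ} {x : FockOp N} (hx : x ∈ linearSpan N) :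
    xᴴ ∈ linearSpan N := by
  obtain ⟨v, rfl⟩ := exists_coeff_of_mem_linearSpan hx
  rw [Matrix.conjTranspose_sum]
  refine sum_mem fun k _ => ?_
  rw [Matrix.conjTranspose_smul, conjTranspose_majorana]
  exact Submodule.smul_mem _ _ (majorana_mem_linearSpan _)

lemma parity_conj_linear {N : ℕ} {x : FockOp N} (hx : x ∈ linearSpan N) :
    parity N * x * parity N = -x := by
  obtain ⟨v, rfl⟩ := exists_coeff_of_mem_linearSpan hx
  simp only [Finset.mul_sum, Finset.sum_mul, mul_smul_comm, smul_mul_assoc,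
    parity_conj_majorana, smul_neg, Finset.sum_neg_distrib]

lemma exists_anticomm_eq {N : ℕ} {x y : FockOp N} (hx : x ∈ linearSpan N)
    (hy : y ∈ linearSpan N) : ∃ b : ℂ, x * y + y * x = b • (1 : FockOp N) := by
  obtain ⟨v, rfl⟩ := exists_coeff_of_mem_linearSpan hx
  obtain ⟨w, rfl⟩ := exists_coeff_of_mem_linearSpan hy
  refine ⟨∑ k, ∑ l, v k * w l * (if k = l then 2 else 0), ?_⟩
  rw [Finset.sum_mul_sum, Finset.sum_mul_sum, Finset.sum_comm (γ := Fin (2 * N)) (s := Finset.univ)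
    (f := fun i j => w i • majorana i * v j • majorana j), ← Finset.sum_add_distrib,
    Finset.sum_smul]
  refine Finset.sum_congr rfl fun k _ => ?_
  rw [← Finset.sum_add_distrib, Finset.sum_smul]
  refine Finset.sum_congr rfl fun l _ => ?_
  rw [mul_smul, ← majorana_anticomm]
  simp only [smul_mul_assoc, mul_smul_comm]
  module

/-! ### Expansion of the Pfaffian along the first row -/

/-- The term of the permutation `σ` in the Pfaffian of `A`. -/
def pfaffianTerm {p : ℕ} (A : Matrix (Fin (2 * p)) (Fin (2 * p)) ℂ)
    (σ : Equiv.Perm (Fin (2 * p))) : ℂ :=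
  ((Equiv.Perm.sign σ : ℤ) : ℂ) *
    ∏ i : Fin p, A (σ ⟨2 * i.val, by omega⟩) (σ ⟨2 * i.val + 1, by omega⟩)

/-- The sign of the transposition is compensated by the antisymmetry of one factor. -/
lemma pfaffianTerm_swap_in_pair {p : ℕ} (A : Matrix (Fin (2 * p)) (Fin (2 * p)) ℂ)
    (hA : ∀ i j, A i j = -A j i) (i : Fin p) (σ : Equiv.Perm (Fin (2 * p))) :
    pfaffianTerm A (σ * Equiv.swap ⟨2 * i.val, by omega⟩ ⟨2 * i.val + 1, by omega⟩) =
      pfaffianTerm A σ := by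
  unfold pfaffianTerm
  rw [Equiv.Perm.sign_mul, Equiv.Perm.sign_swap (by simp)]
  have : ∀ k : Fin p,
      A ((σ * Equiv.swap (⟨2 * i.val, by omega⟩ : Fin (2 * p)) ⟨2 * i.val + 1, by omega⟩)
          ⟨2 * k.val, by omega⟩)
        ((σ * Equiv.swap (⟨2 * i.val, by omega⟩ : Fin (2 * p)) ⟨2 * i.val + 1, by omega⟩)
          ⟨2 * k.val + 1, by omega⟩) =
      (if k = i then -1 else 1) *
        A (σ ⟨2 * k.val, by omega⟩) (σ ⟨2 * k.val + 1, by omega⟩) := by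
    intro k
    simp only [Equiv.Perm.mul_apply]
    by_cases hk : k = i
    · subst hk
      rw [Equiv.swap_apply_left, Equiv.swap_apply_right, hA]
      simp
    · have hv : k.val ≠ i.val := fun h => hk (Fin.ext h)
      rw [Equiv.swap_apply_of_ne_of_ne, Equiv.swap_apply_of_ne_of_ne] <;>
        first | (simp only [ne_eq, Fin.mk.injEq]; omega) | simp [hk]
  rw [Finset.prod_congr rfl fun k _ => this k, Finset.prod_mul_distrib]
  simp

/-- Exchanging two whole pairs is an even permutation and only reorders the factors. -/
lemma pfaffianTerm_swap_pairs {p : ℕ} (A : Matrix (Fin (2 * p)) (Fin (2 * p)) ℂ)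
    (i j : Fin p) (σ : Equiv.Perm (Fin (2 * p))) :
    pfaffianTerm A (σ * (Equiv.swap ⟨2 * j.val, by omega⟩ ⟨2 * i.val, by omega⟩ *
      Equiv.swap ⟨2 * j.val + 1, by omega⟩ ⟨2 * i.val + 1, by omega⟩)) = pfaffianTerm A σ := by
  unfold pfaffianTerm
  congr 1
  · by_cases hij : i = j
    · subst hij; simp
    · have hv : j.val ≠ i.val := fun h => hij (Fin.ext h.symm)
      rw [Equiv.Perm.sign_mul, Equiv.Perm.sign_mul,
        Equiv.Perm.sign_swap (by simpa using hv), Equiv.Perm.sign_swap (by simpa using hv)]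
      simp
  · rw [← Equiv.prod_comp (Equiv.swap j i)]
    refine Finset.prod_congr rfl fun k _ => ?_
    simp only [Equiv.Perm.mul_apply]
    congr 2
    · rw [Equiv.swap_apply_of_ne_of_ne (a := (⟨2 * j.val + 1, _⟩ : Fin (2 * p)))]
      · simp only [Equiv.swap_apply_def, Fin.ext_iff]
        split_ifs <;> simp <;> omega
      · simp only [ne_eq, Fin.mk.injEq]; omega
      · simp only [ne_eq, Fin.mk.injEq]; omega
    · rw [Equiv.swap_apply_of_ne_of_ne (a := (⟨2 * j.val, _⟩ : Fin (2 * p)))]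
      · simp only [Equiv.swap_apply_def, Fin.ext_iff]
        split_ifs <;> simp <;> omega
      · simp only [Equiv.swap_apply_def, ne_eq, Fin.ext_iff]
        split_ifs <;> simp <;> omega
      · simp only [Equiv.swap_apply_def, ne_eq, Fin.ext_iff]
        split_ifs <;> simp <;> omega

lemma sum_perm_fixing_zero {n : ℕ} (g : Equiv.Perm (Fin (n + 1)) → ℂ) :
    ∑ σ : Equiv.Perm (Fin (n + 1)), (if σ 0 = 0 then g σ else 0) =
      ∑ f : Equiv.Perm (Fin n), g (Equiv.Perm.decomposeFin.symm (0, f)) := by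
  rw [← Equiv.Perm.decomposeFin.symm.sum_comp, Fintype.sum_prod_type]
  simp only [Equiv.Perm.decomposeFin_symm_apply_zero]
  rw [Finset.sum_eq_single 0 (by intro b _ hb; simp [hb]) (by simp)]
  simp

/-- The symmetries of the terms act transitively on positions: exchange the pair containing m with
the first pair and, for odd m, also swap inside the pair. -/
lemma exists_perm_pfaffianTerm {p : ℕ} (A : Matrix (Fin (2 * p + 1 + 1)) (Fin (2 * p + 1 + 1)) ℂ)
    (hA : ∀ i j, A i j = -A j i) (m : Fin (2 * p + 1 + 1)) :
    ∃ τ : Equiv.Perm (Fin (2 * p + 1 + 1)), τ 0 = m ∧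
      ∀ σ, pfaffianTerm (p := p + 1) A (σ * τ) = pfaffianTerm (p := p + 1) A σ := by
  have hi : m.val / 2 < p + 1 := by omega
  have hswap : ∀ i : Fin (p + 1), ((Equiv.swap (⟨2 * (0 : Fin (p + 1)).val, by omega⟩ :
      Fin (2 * (p + 1))) ⟨2 * i.val, by omega⟩ *
      Equiv.swap ⟨2 * (0 : Fin (p + 1)).val + 1, by omega⟩ ⟨2 * i.val + 1, by omega⟩ :
      Equiv.Perm (Fin (2 * (p + 1)))) ⟨0, by omega⟩) = ⟨2 * i.val, by omega⟩ := by
    intro i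
    simp only [Equiv.Perm.mul_apply, Equiv.swap_apply_def, Fin.ext_iff]
    simp
  rcases Nat.mod_two_eq_zero_or_one m.val with h | h
  · refine ⟨_, ?_, pfaffianTerm_swap_pairs (p := p + 1) A ⟨m.val / 2, hi⟩ 0⟩
    refine (hswap ⟨m.val / 2, hi⟩).trans ?_
    ext
    change 2 * (m.val / 2) = m.val
    omega
  · refine ⟨Equiv.swap ⟨2 * (m.val / 2), by omega⟩ ⟨2 * (m.val / 2) + 1, by omega⟩ *
      (Equiv.swap (⟨2 * (0 : Fin (p + 1)).val, by simp⟩ :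
      Fin (2 * (p + 1))) ⟨2 * (m.val / 2), by omega⟩ *
      Equiv.swap ⟨2 * (0 : Fin (p + 1)).val + 1, by simp; omega⟩ ⟨2 * (m.val / 2) + 1, by omega⟩), ?_, ?_⟩
    · rw [Equiv.Perm.mul_apply]
      have := hswap ⟨m.val / 2, hi⟩
      refine (congrArg _ this).trans ?_
      refine (Equiv.swap_apply_left _ _).trans ?_
      ext
      change 2 * (m.val / 2) + 1 = m.val
      omega
    · intro σ
      rw [← mul_assoc]
      refine (pfaffianTerm_swap_pairs (p := p + 1) A ⟨m.val / 2, hi⟩ 0 _).trans ?_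
      exact pfaffianTerm_swap_in_pair (p := p + 1) A hA ⟨m.val / 2, hi⟩ σ

/-- Group the permutations by the position of the value 0. By symmetry all 2(p + 1) positions
contribute equally, and this factor is the ratio of 2^(p+1) (p+1)! to 2^p p!. -/
lemma sum_pfaffianTerm {p : ℕ} (A : Matrix (Fin (2 * p + 1 + 1)) (Fin (2 * p + 1 + 1)) ℂ)
    (hA : ∀ i j, A i j = -A j i) :
    ∑ σ : Equiv.Perm (Fin (2 * p + 1 + 1)), pfaffianTerm (p := p + 1) A σ =
      (2 * (p + 1) : ℂ) * ∑ e : Equiv.Perm (Fin (2 * p + 1)),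
        pfaffianTerm (p := p + 1) A (Equiv.Perm.decomposeFin.symm (0, e)) := by
  have h1 : ∀ σ : Equiv.Perm (Fin (2 * p + 1 + 1)), pfaffianTerm (p := p + 1) A σ =
      ∑ m, if σ m = 0 then pfaffianTerm (p := p + 1) A σ else 0 := by
    intro σ
    rw [Finset.sum_eq_single (σ.symm 0)]
    · simp
    · intro b _ hb
      rw [if_neg]
      rintro h
      exact hb (by rw [← h]; simp)
    · simp
  rw [Finset.sum_congr rfl fun σ _ => h1 σ, Finset.sum_comm]
  have h2 : ∀ m : Fin (2 * p + 1 + 1),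
      ∑ σ : Equiv.Perm (Fin (2 * p + 1 + 1)),
        (if σ m = 0 then pfaffianTerm (p := p + 1) A σ else 0) =
      ∑ e : Equiv.Perm (Fin (2 * p + 1)),
        pfaffianTerm (p := p + 1) A (Equiv.Perm.decomposeFin.symm (0, e)) := by
    intro m
    obtain ⟨τ, hτ, hT⟩ := exists_perm_pfaffianTerm A hA m
    refine Eq.trans ?_ ((Equiv.sum_comp (Equiv.mulRight τ) _).trans
      (sum_perm_fixing_zero (pfaffianTerm (p := p + 1) A)))
    refine Finset.sum_congr rfl fun σ _ => ?_
    simp only [Equiv.coe_mulRight, Equiv.Perm.mul_apply, hτ, hT]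
  rw [Finset.sum_congr rfl fun m _ => h2 m]
  simp only [Finset.sum_const, Finset.card_univ, Fintype.card_fin, nsmul_eq_mul]
  push_cast
  ring

/-- These are the permutations that pair row 0 with row `m.succ`. The inverse of `m.cycleRange`
sends 0 to m, enumerates the other indices in increasing order, and has sign (-1)^m. -/
lemma pfaffianTerm_cycleRange {p : ℕ}
    (A : Matrix (Fin (2 * p + 1 + 1)) (Fin (2 * p + 1 + 1)) ℂ) (m : Fin (2 * p + 1))
    (f : Equiv.Perm (Fin (2 * p))) :
    pfaffianTerm (p := p + 1) A (Equiv.Perm.decomposeFin.symm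
      (0, m.cycleRange⁻¹ * Equiv.Perm.decomposeFin.symm (0, f))) =
    (-1 : ℂ) ^ (m : ℕ) * A 0 m.succ *
      pfaffianTerm (A.submatrix (fun i => (m.succAbove i).succ)
        (fun i => (m.succAbove i).succ)) f := by
  set e : Equiv.Perm (Fin (2 * p + 1)) :=
    m.cycleRange⁻¹ * Equiv.Perm.decomposeFin.symm (0, f) with he
  set σ : Equiv.Perm (Fin (2 * p + 1 + 1)) := Equiv.Perm.decomposeFin.symm (0, e) with hσ
  have e0 : e 0 = m := by
    rw [he, Equiv.Perm.mul_apply, Equiv.Perm.decomposeFin_symm_apply_zero]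
    exact Fin.cycleRange_symm_zero m
  have es : ∀ i, e i.succ = m.succAbove (f i) := by
    intro i
    rw [he, Equiv.Perm.mul_apply, Equiv.Perm.decomposeFin_symm_apply_succ, Equiv.swap_self]
    exact Fin.cycleRange_symm_succ m (f i)
  have s0 : σ 0 = 0 := Equiv.Perm.decomposeFin_symm_apply_zero 0 e
  have ss : ∀ i, σ i.succ = (e i).succ := by
    intro i
    rw [hσ, Equiv.Perm.decomposeFin_symm_apply_succ, Equiv.swap_self]
    rfl
  have hsign : ((Equiv.Perm.sign σ : ℤ) : ℂ) =
      (-1 : ℂ) ^ (m : ℕ) * ((Equiv.Perm.sign f : ℤ) : ℂ) := by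
    rw [hσ, Equiv.Perm.decomposeFin.symm_sign, he, Equiv.Perm.sign_mul, Equiv.Perm.sign_inv,
      Fin.sign_cycleRange, Equiv.Perm.decomposeFin.symm_sign]
    simp
  have h0 : A (σ ⟨2 * (0 : Fin (p + 1)).val, by simp⟩)
      (σ ⟨2 * (0 : Fin (p + 1)).val + 1, by simp⟩) = A 0 m.succ := by
    have h1 : σ ⟨2 * (0 : Fin (p + 1)).val + 1, by simp⟩ = m.succ := by
      rw [← e0]; exact ss 0
    rw [h1]
    exact congrArg (fun x => A x m.succ) s0
  have hs : ∀ i : Fin p, A (σ ⟨2 * i.succ.val, by have := i.succ.isLt; omega⟩)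
      (σ ⟨2 * i.succ.val + 1, by have := i.succ.isLt; omega⟩) =
      A (m.succAbove (f ⟨2 * i.val, by omega⟩)).succ
        (m.succAbove (f ⟨2 * i.val + 1, by omega⟩)).succ := by
    intro i
    rw [← es, ← es, ← ss, ← ss]
    rfl
  unfold pfaffianTerm
  refine (congrArg₂ (· * ·) hsign (Fin.prod_univ_succ _)).trans ?_
  refine (congrArg _ (congrArg₂ (· * ·) h0 (Finset.prod_congr rfl fun i _ => hs i))).trans ?_
  simp only [Matrix.submatrix_apply]
  ring

lemma pfaffian_zero (A : Matrix (Fin (2 * 0)) (Fin (2 * 0)) ℂ) : pfaffian A = 1 := by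
  simp [pfaffian]

/-- Expansion of the Pfaffian along the first row. -/
theorem pfaffian_succ {p : ℕ} (A : Matrix (Fin (2 * p + 1 + 1)) (Fin (2 * p + 1 + 1)) ℂ)
    (hA : ∀ i j, A i j = -A j i) :
    pfaffian (p := p + 1) A = ∑ m : Fin (2 * p + 1), (-1 : ℂ) ^ (m : ℕ) * A 0 m.succ *
      pfaffian (A.submatrix (fun i => (m.succAbove i).succ) (fun i => (m.succAbove i).succ)) := by
  -- The permutations fixing 0 are sorted by the partner m of row 0.
  have h1 : ∑ e : Equiv.Perm (Fin (2 * p + 1)),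
      pfaffianTerm (p := p + 1) A (Equiv.Perm.decomposeFin.symm (0, e)) =
      ∑ m : Fin (2 * p + 1), ∑ f : Equiv.Perm (Fin (2 * p)),
        pfaffianTerm (p := p + 1) A (Equiv.Perm.decomposeFin.symm
          (0, m.cycleRange⁻¹ * Equiv.Perm.decomposeFin.symm (0, f))) := by
    have h2 : ∀ e : Equiv.Perm (Fin (2 * p + 1)),
        pfaffianTerm (p := p + 1) A (Equiv.Perm.decomposeFin.symm (0, e)) =
        ∑ m, if e 0 = m then
          pfaffianTerm (p := p + 1) A (Equiv.Perm.decomposeFin.symm (0, e)) else 0 := by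
      intro e; simp
    rw [Finset.sum_congr rfl fun e _ => h2 e, Finset.sum_comm]
    refine Finset.sum_congr rfl fun m _ => ?_
    rw [← sum_perm_fixing_zero (fun e => pfaffianTerm (p := p + 1) A
      (Equiv.Perm.decomposeFin.symm (0, m.cycleRange⁻¹ * e))),
      ← Equiv.sum_comp (Equiv.mulLeft m.cycleRange⁻¹)]
    refine Finset.sum_congr rfl fun e _ => ?_
    have h3 : (m.cycleRange⁻¹ * e) 0 = m ↔ e 0 = 0 := by
      rw [Equiv.Perm.mul_apply, Equiv.Perm.inv_eq_iff_eq, Fin.cycleRange_self]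
    simp only [Equiv.coe_mulLeft, h3]
  have h4 : pfaffian (p := p + 1) A = ((2 : ℂ) ^ (p + 1) * ((p + 1).factorial : ℂ))⁻¹ *
    ∑ σ : Equiv.Perm (Fin (2 * p + 1 + 1)), pfaffianTerm (p := p + 1) A σ := rfl
  rw [h4, sum_pfaffianTerm A hA, h1, Finset.mul_sum, Finset.mul_sum]
  refine Finset.sum_congr rfl fun m _ => ?_
  rw [Finset.sum_congr rfl fun f _ => pfaffianTerm_cycleRange A m f, ← Finset.mul_sum]
  have h5 : ∀ B : Matrix (Fin (2 * p)) (Fin (2 * p)) ℂ, pfaffian B =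
    ((2 : ℂ) ^ p * (p.factorial : ℂ))⁻¹ * ∑ σ, pfaffianTerm B σ := fun B => rfl
  rw [h5, Nat.factorial_succ]
  have hp : (p.factorial : ℂ) ≠ 0 := by exact_mod_cast p.factorial_ne_zero
  have hp1 : (p + 1 : ℂ) ≠ 0 := by exact_mod_cast p.succ_ne_zero
  push_cast
  field_simp
  ring

/-! ### Wick's formula as the vanishing of the defects -/

/-- The two-point function `tr(ρ c_j c_k)`. -/
def twoPoint {N : ℕ} (ρ : FockOp N) (j k : Fin (2 * N)) : ℂ :=
  (ρ * (majorana j * majorana k)).trace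

/-- The linear operator `g_j = ½ ∑_k tr(ρ c_j c_k) c_k`. -/
def meanField {N : ℕ} (ρ : FockOp N) (j : Fin (2 * N)) : FockOp N :=
  ∑ k, (twoPoint ρ j k / 2) • majorana k

/-- The defect `ρ c_j - {ρ, g_j}`, which vanishes for all `j` if and only if Wick's formula holds. -/
def wickDefect {N : ℕ} (ρ : FockOp N) (j : Fin (2 * N)) : FockOp N :=
  ρ * majorana j - (ρ * meanField ρ j + meanField ρ j * ρ)

lemma meanField_mem {N : ℕ} (ρ : FockOp N) (j : Fin (2 * N)) :
    meanField ρ j ∈ linearSpan N :=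
  sum_mem fun _ _ => Submodule.smul_mem _ _ (majorana_mem_linearSpan _)

/-- The ½ in `meanField` cancels the 2 in {c_k, c_k} = 2, so that anticommuting g_j with c_k
produces exactly the contraction of c_j and c_k. -/
lemma meanField_anticomm {N : ℕ} (ρ : FockOp N) (j k : Fin (2 * N)) :
    meanField ρ j * majorana k + majorana k * meanField ρ j = twoPoint ρ j k • (1 : FockOp N) := by
  unfold meanField
  rw [Finset.sum_mul, Finset.mul_sum, ← Finset.sum_add_distrib]
  simp only [smul_mul_assoc, mul_smul_comm, ← smul_add, majorana_anticomm]
  rw [Finset.sum_eq_single k (by intro b _ hb; simp [hb]) (by simp), if_pos rfl, smul_smul,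
    div_mul_cancel₀ _ two_ne_zero]

lemma twoPoint_add_twoPoint {N : ℕ} {ρ : FockOp N} (h1 : ρ.trace = 1) (j k : Fin (2 * N)) :
    twoPoint ρ j k + twoPoint ρ k j = if j = k then 2 else 0 := by
  unfold twoPoint
  rw [← Matrix.trace_add, ← mul_add, majorana_anticomm, mul_smul_comm, mul_one,
    Matrix.trace_smul, h1, smul_eq_mul, mul_one]

lemma covarianceMatrix_antisymm {N : ℕ} (ρ : FockOp N) (j k : Fin (2 * N)) :
    covarianceMatrix ρ j k = -covarianceMatrix ρ k j := by
  simp only [covarianceMatrix, Matrix.of_apply]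
  rw [← mul_neg, ← Matrix.trace_neg, ← mul_neg, neg_sub]

lemma covarianceMatrix_of_ne {N : ℕ} (ρ : FockOp N) {j k : Fin (2 * N)} (h : j ≠ k) :
    covarianceMatrix ρ j k = Complex.I * twoPoint ρ j k := by
  have h1 := majorana_anticomm j k
  rw [if_neg h, zero_smul] at h1
  simp only [covarianceMatrix, Matrix.of_apply, twoPoint]
  rw [eq_neg_of_add_eq_zero_right h1, sub_neg_eq_add, ← two_smul ℂ, mul_smul_comm,
    Matrix.trace_smul, smul_eq_mul]
  ring

lemma trace_mul_eq_zero_of_odd {N : ℕ} {ρ x : FockOp N} (hρ : parity N * ρ * parity N = ρ)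
    (hx : parity N * x * parity N = -x) : (ρ * x).trace = 0 := by
  have h : (ρ * x).trace = -(ρ * x).trace := by
    calc (ρ * x).trace = (parity N * ρ * parity N * x).trace := by rw [hρ]
      _ = (ρ * (parity N * x * parity N)).trace := by
        rw [mul_assoc, mul_assoc, Matrix.trace_mul_comm]
        simp only [mul_assoc]
      _ = -(ρ * x).trace := by rw [hx, mul_neg, Matrix.trace_neg]
  exact self_eq_neg.1 h

lemma parity_conj_mul {N : ℕ} (x y : FockOp N) :
    parity N * (x * y) * parity N = (parity N * x * parity N) * (parity N * y * parity N) := by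
  simp only [mul_assoc]
  rw [← mul_assoc (parity N) (parity N), parity_mul_parity, one_mul]

lemma trace_wickDefect_mul {N : ℕ} (ρ : FockOp N) (k : Fin (2 * N)) (x : FockOp N) :
    (wickDefect ρ k * x).trace =
      (ρ * (majorana k * x - (meanField ρ k * x + x * meanField ρ k))).trace := by
  unfold wickDefect
  simp only [sub_mul, add_mul, mul_sub, mul_add, Matrix.trace_sub, Matrix.trace_add, mul_assoc]
  rw [Matrix.trace_mul_comm (meanField ρ k) (ρ * x), mul_assoc]

lemma trace_wickDefect_mul_eq_zero_of_even {N : ℕ} {ρ : FockOp N}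
    (hρ : parity N * ρ * parity N = ρ) (k : Fin (2 * N)) {x : FockOp N}
    (hx : parity N * x * parity N = x) : (wickDefect ρ k * x).trace = 0 := by
  rw [trace_wickDefect_mul]
  refine trace_mul_eq_zero_of_odd hρ ?_
  rw [mul_sub, sub_mul, mul_add, add_mul, parity_conj_mul, parity_conj_mul, parity_conj_mul, hx,
    parity_conj_majorana, parity_conj_linear (meanField_mem ρ k)]
  simp only [neg_mul, mul_neg]
  abel

lemma meanField_mul_word {N n : ℕ} (ρ : FockOp N) (k : Fin (2 * N))
    (j : Fin (n + 1) → Fin (2 * N)) :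
    meanField ρ k * word j - (-1 : ℂ) ^ (n + 1) • (word j * meanField ρ k) =
      ∑ m : Fin (n + 1), ((-1 : ℂ) ^ (m : ℕ) * twoPoint ρ k (j m)) •
        word (fun i => j (m.succAbove i)) := by
  have h : meanField ρ k * word j - (-1 : ℂ) ^ (n + 1) • (word j * meanField ρ k) =
      ∑ l, (twoPoint ρ k l / 2) •
        (majorana l * word j - (-1 : ℂ) ^ (n + 1) • (word j * majorana l)) := by
    unfold meanField
    rw [Finset.sum_mul, Finset.mul_sum, Finset.smul_sum, ← Finset.sum_sub_distrib]
    refine Finset.sum_congr rfl fun l _ => ?_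
    rw [smul_mul_assoc, mul_smul_comm, smul_sub, smul_comm]
  rw [h]
  simp only [majorana_mul_word, Finset.smul_sum]
  rw [Finset.sum_comm]
  refine Finset.sum_congr rfl fun m _ => ?_
  rw [Finset.sum_eq_single (j m) (by intro b _ hb; simp [hb]) (by simp), smul_smul]
  congr 1
  rw [if_pos rfl]
  ring

/-- Moving g_k through the word contracts c_k with each letter in turn, so this trace measures the
failure of one step of the Wick recursion. -/
lemma trace_wickDefect_mul_word {N p : ℕ} (ρ : FockOp N) (k : Fin (2 * N))
    (j : Fin (2 * p + 1) → Fin (2 * N)) :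
    (wickDefect ρ k * word j).trace = (ρ * (majorana k * word j)).trace -
      ∑ m : Fin (2 * p + 1), (-1 : ℂ) ^ (m : ℕ) * twoPoint ρ k (j m) *
        (ρ * word (fun i => j (m.succAbove i))).trace := by
  have h := meanField_mul_word ρ k j
  have hs : (-1 : ℂ) ^ (2 * p + 1) = -1 := by rw [pow_succ, pow_mul]; simp
  rw [hs, neg_smul, one_smul, sub_neg_eq_add] at h
  rw [trace_wickDefect_mul, h, mul_sub, Matrix.trace_sub, Finset.mul_sum, Matrix.trace_sum]
  congr 1
  refine Finset.sum_congr rfl fun m _ => ?_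
  rw [mul_smul_comm, Matrix.trace_smul, smul_eq_mul]

/-- Each contraction supplies one factor i of the covariance matrix. Distinct indices are needed
because on the diagonal the covariance vanishes while the two-point function is 1. -/
lemma wick_of_wickDefect_eq_zero {N : ℕ} {ρ : FockOp N} (h1 : ρ.trace = 1)
    (hE : ∀ k, wickDefect ρ k = 0) (p : ℕ) (j : Fin (2 * p) → Fin (2 * N))
    (hj : Function.Injective j) :
    Complex.I ^ p * moment ρ j = pfaffian ((covarianceMatrix ρ).submatrix j j) := by
  induction p with
  | zero =>
    rw [pfaffian_zero, moment_eq, word_zero, mul_one, h1, pow_zero, mul_one]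
  | succ p ih =>
    have ih' := fun m : Fin (2 * p + 1) => ih (fun i => j (m.succAbove i).succ)
      (hj.comp ((Fin.succ_injective _).comp Fin.succAbove_right_injective))
    have hp := pfaffian_succ (p := p) ((covarianceMatrix ρ).submatrix j j)
      (fun _ _ => covarianceMatrix_antisymm _ _ _)
    refine Eq.trans ?_ hp.symm
    have hw : moment ρ j = (ρ * (majorana (j 0) * word (fun i : Fin (2 * p + 1) =>
      j i.succ))).trace := congrArg (fun x => (ρ * x).trace) (word_succ (n := 2 * p + 1) j)
    have hd := trace_wickDefect_mul_word ρ (j 0) (fun i : Fin (2 * p + 1) => j i.succ)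
    rw [hE, zero_mul, Matrix.trace_zero] at hd
    rw [hw, sub_eq_zero.1 hd.symm, Finset.mul_sum]
    refine Finset.sum_congr rfl fun m _ => ?_
    have hne : j 0 ≠ j m.succ := fun h => (Fin.succ_ne_zero m) (hj h).symm
    have hc : (covarianceMatrix ρ).submatrix j j 0 m.succ =
      Complex.I * twoPoint ρ (j 0) (j m.succ) := covarianceMatrix_of_ne ρ hne
    rw [hc, Matrix.submatrix_submatrix]
    change _ = _ * pfaffian ((covarianceMatrix ρ).submatrix (fun i => j (m.succAbove i).succ)
      (fun i => j (m.succAbove i).succ))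
    rw [← ih', moment_eq, pow_succ]
    ring

lemma isGaussianState_of_wickDefect {N : ℕ} {ρ : FockOp N} (hs : IsState ρ)
    (hρ : parity N * ρ * parity N = ρ) (hE : ∀ k, wickDefect ρ k = 0) : IsGaussianState ρ where
  isState := hs
  odd p j _ := by
    rw [moment_eq]
    refine trace_mul_eq_zero_of_odd hρ ?_
    rw [parity_conj_word, pow_succ, pow_mul]
    simp
  wick p j hj := wick_of_wickDefect_eq_zero hs.2 hE p j hj.injective

lemma pairwise_ofFn_lt {N n : ℕ} {j : Fin n → Fin (2 * N)} :
    (List.ofFn j).Pairwise (· < ·) ↔ StrictMono j := by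
  rw [List.pairwise_ofFn]; rfl

lemma exists_strictMono_of_pairwise {N : ℕ} {l : List (Fin (2 * N))} (hl : l.Pairwise (· < ·)) :
    ∃ (n : ℕ) (j : Fin n → Fin (2 * N)), StrictMono j ∧ l = List.ofFn j := by
  refine ⟨l.length, l.get, ?_, (List.ofFn_get l).symm⟩
  rw [← pairwise_ofFn_lt, List.ofFn_get]
  exact hl

lemma IsGaussianState.parity_conj {N : ℕ} {ρ : FockOp N} (h : IsGaussianState ρ) :
    parity N * ρ * parity N = ρ := by
  rw [← sub_eq_zero]
  refine eq_zero_of_trace_mul_listWord fun l hl => ?_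
  obtain ⟨n, j, hj, rfl⟩ := exists_strictMono_of_pairwise hl
  have h2 : (parity N * ρ * parity N * word j).trace = (-1 : ℂ) ^ n * (ρ * word j).trace := by
    rw [mul_assoc, mul_assoc, Matrix.trace_mul_comm, mul_assoc, parity_conj_word, mul_smul_comm,
      Matrix.trace_smul, smul_eq_mul]
  rw [listWord_ofFn, sub_mul, Matrix.trace_sub, h2]
  obtain ⟨p, rfl | rfl⟩ := n.even_or_odd'
  · rw [pow_mul]; simp
  · have h3 := h.odd p j hj
    rw [moment_eq] at h3
    simp [h3]

/-- Even words are excluded by parity. For odd ones, putting l in front keeps the indices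
increasing, so Wick's formula applies to the long word and to every shorter one in its Pfaffian
expansion. -/
lemma IsGaussianState.trace_wickDefect_of_lt {N : ℕ} {ρ : FockOp N} (h : IsGaussianState ρ)
    {l : Fin (2 * N)} {n : ℕ} {j : Fin n → Fin (2 * N)} (hj : StrictMono j) (hl : ∀ i, l < j i) :
    (wickDefect ρ l * word j).trace = 0 := by
  obtain ⟨p, rfl | rfl⟩ := n.even_or_odd'
  · refine trace_wickDefect_mul_eq_zero_of_even h.parity_conj l ?_
    rw [parity_conj_word, pow_mul]
    simp
  · set J : Fin (2 * p + 1 + 1) → Fin (2 * N) := Fin.cons l j with hJ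
    have hJm : StrictMono J := by
      rw [← pairwise_ofFn_lt, hJ, List.ofFn_cons, List.pairwise_cons]
      refine ⟨fun a ha => ?_, pairwise_ofFn_lt.2 hj⟩
      obtain ⟨i, rfl⟩ := (List.mem_ofFn' _ _).1 ha
      exact hl i
    have hw := h.wick (p + 1) J hJm
    have hp := pfaffian_succ (p := p) ((covarianceMatrix ρ).submatrix J J)
      (fun _ _ => covarianceMatrix_antisymm _ _ _)
    have hm : moment (n := 2 * (p + 1)) ρ J = (ρ * (majorana l * word j)).trace :=
      congrArg (fun x => (ρ * x).trace) (word_cons l j)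
    have hw' := hw.trans hp
    rw [hm] at hw'
    have hterm : ∀ m : Fin (2 * p + 1),
        (-1 : ℂ) ^ (m : ℕ) * (covarianceMatrix ρ).submatrix J J 0 m.succ *
          pfaffian (((covarianceMatrix ρ).submatrix J J).submatrix
            (fun i => (m.succAbove i).succ) (fun i => (m.succAbove i).succ)) =
        Complex.I ^ (p + 1) * ((-1 : ℂ) ^ (m : ℕ) * twoPoint ρ l (j m) *
          (ρ * word (fun i => j (m.succAbove i))).trace) := by
      intro m
      have hc : (covarianceMatrix ρ).submatrix J J 0 m.succ =
        Complex.I * twoPoint ρ l (j m) := covarianceMatrix_of_ne ρ (hl m).ne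
      rw [hc, Matrix.submatrix_submatrix]
      change _ * pfaffian ((covarianceMatrix ρ).submatrix (fun i => j (m.succAbove i))
        (fun i => j (m.succAbove i))) = _
      rw [← h.wick p (fun i => j (m.succAbove i)) (hj.comp (Fin.strictMono_succAbove m)), moment_eq, pow_succ]
      ring
    rw [Finset.sum_congr rfl fun m _ => hterm m, ← Finset.mul_sum] at hw'
    rw [trace_wickDefect_mul_word, sub_eq_zero]
    exact mul_left_cancel₀ (pow_ne_zero _ Complex.I_ne_zero) hw'

/-- The operators orthogonal to the defect with index `k`. -/
def defectKernel {N : ℕ} (ρ : FockOp N) (k : Fin (2 * N)) : Submodule ℂ (FockOp N) where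
  carrier := {x | (wickDefect ρ k * x).trace = 0}
  zero_mem' := by simp
  add_mem' {x y} hx hy := by
    simp only [Set.mem_ofPred_eq] at hx hy ⊢
    rw [mul_add, Matrix.trace_add, hx, hy, add_zero]
  smul_mem' c x hx := by
    simp only [Set.mem_ofPred_eq] at hx ⊢
    rw [mul_smul_comm, Matrix.trace_smul, hx, smul_zero]

lemma mem_defectKernel {N : ℕ} {ρ : FockOp N} {k : Fin (2 * N)} {x : FockOp N} :
    x ∈ defectKernel ρ k ↔ (wickDefect ρ k * x).trace = 0 := Iff.rfl

lemma IsGaussianState.sortedSpan_le {N : ℕ} {ρ : FockOp N} (h : IsGaussianState ρ)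
    (l : Fin (2 * N)) : sortedSpan (fun a => l < a) ≤ defectKernel ρ l := by
  refine Submodule.span_le.2 ?_
  rintro _ ⟨w, hw, hl, rfl⟩
  obtain ⟨n, j, hj, rfl⟩ := exists_strictMono_of_pairwise hw
  rw [listWord_ofFn]
  exact h.trace_wickDefect_of_lt hj fun i => hl _ ((List.mem_ofFn' _ _).2 ⟨i, rfl⟩)

/-- Added to the expanded hypotheses, the discrepancy consists of ({c_k, c_l} - {g_k, c_l} - {g_l,
c_k}) y, zero by the symmetrised two-point function, and of the commutator of y with the scalar
{g_k, g_l}. -/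
lemma trace_wickDefect_majorana_mul {N : ℕ} {ρ y : FockOp N} (h1 : ρ.trace = 1)
    (k l : Fin (2 * N))
    (hl : meanField ρ k * y - y * meanField ρ k ∈ defectKernel ρ l)
    (hk : meanField ρ l * y - y * meanField ρ l ∈ defectKernel ρ k) :
    (wickDefect ρ k * (majorana l * y)).trace = -(wickDefect ρ l * (majorana k * y)).trace := by
  rw [mem_defectKernel, trace_wickDefect_mul] at hl hk
  obtain ⟨b, hb⟩ := exists_anticomm_eq (meanField_mem ρ k) (meanField_mem ρ l)
  have hc := majorana_anticomm k l
  have hkl := meanField_anticomm ρ k l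
  have hlk := meanField_anticomm ρ l k
  have ht := twoPoint_add_twoPoint h1 k l
  rw [trace_wickDefect_mul, trace_wickDefect_mul, ← add_eq_zero_iff_eq_neg, ← Matrix.trace_add,
    ← mul_add]
  rw [← add_zero (0 : ℂ), ← congrArg₂ (· + ·) hl hk, ← Matrix.trace_add, ← mul_add]
  congr 2
  set g := meanField ρ k
  set g' := meanField ρ l
  set c : FockOp N := majorana k
  set c' : FockOp N := majorana l
  rw [← ht, add_smul, ← hkl, ← hlk] at hc
  have e1 : (c * c' + c' * c) * y = (g * c' + c' * g + (g' * c + c * g')) * y := by rw [hc]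
  have e2 : (g * g' + g' * g) * y = y * (g * g' + g' * g) := by rw [hb]; simp
  simp only [mul_add, add_mul, mul_sub, sub_mul, mul_assoc] at e1 e2 ⊢
  have e1' := sub_eq_zero.2 e1
  have e2' := sub_eq_zero.2 e2
  rw [← sub_eq_zero]
  rw [← add_zero (0 : FockOp N), ← congrArg₂ (· + ·) e1' e2']
  abel

/-- Induction on the length. For an odd word, a commutator of g_a with the tail is a combination of
words two letters shorter than the given one, so the exchange relation is available. If k is the
first index, it says that the trace equals its own negative. If k is larger, it passes to the defect
of the first index, tested on letters that all exceed that index. -/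
lemma IsGaussianState.word_mem_defectKernel {N : ℕ} {ρ : FockOp N} (h : IsGaussianState ρ)
    (n : ℕ) (k : Fin (2 * N)) (j : Fin n → Fin (2 * N)) (hj : StrictMono j) :
    word j ∈ defectKernel ρ k := by
  induction n using Nat.strong_induction_on generalizing k with
  | _ n ih =>
  obtain ⟨p, rfl | rfl⟩ := n.even_or_odd'
  · refine trace_wickDefect_mul_eq_zero_of_even h.parity_conj k ?_
    rw [parity_conj_word, pow_mul]
    simp
  have hj' : StrictMono fun i : Fin (2 * p) => j i.succ := hj.comp (Fin.strictMono_succ)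
  have h0 : ∀ i : Fin (2 * p), j 0 < j i.succ := fun i => hj (Fin.succ_pos i)
  have hcomm : ∀ a b : Fin (2 * N), meanField ρ a * word (fun i : Fin (2 * p) => j i.succ) -
      word (fun i : Fin (2 * p) => j i.succ) * meanField ρ a ∈ defectKernel ρ b := by
    intro a b
    rcases p with _ | q
    · have : (word (fun i : Fin (2 * 0) => j i.succ) : FockOp N) = 1 := word_zero _
      rw [this, mul_one, one_mul, sub_self]
      exact zero_mem _
    · have hm := meanField_mul_word (n := 2 * q + 1) ρ a (fun i => j i.succ)
      have hs : (-1 : ℂ) ^ (2 * q + 1 + 1) = 1 := by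
        rw [show 2 * q + 1 + 1 = 2 * (q + 1) by ring, pow_mul]; simp
      rw [hs, one_smul] at hm
      refine (congrArg (· ∈ defectKernel ρ b) hm).mpr ?_
      refine sum_mem fun m _ => Submodule.smul_mem _ _ ?_
      exact ih (2 * q + 1) (by omega) b _ (hj'.comp (Fin.strictMono_succAbove m))
  rcases lt_or_ge k (j 0) with hk | hk
  · exact h.trace_wickDefect_of_lt hj fun i => lt_of_lt_of_le hk (hj.monotone (Fin.zero_le i))
  rw [mem_defectKernel, word_succ]
  have hanti := trace_wickDefect_majorana_mul h.isState.2 k (j 0) (hcomm _ _) (hcomm _ _)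
  rcases hk.eq_or_lt with hk | hk
  · rw [← hk] at hanti ⊢
    exact self_eq_neg.1 hanti
  · rw [hanti, neg_eq_zero]
    refine h.sortedSpan_le (j 0) ?_
    rw [← listWord_ofFn]
    refine majorana_mul_listWord_mem _ _ _ (pairwise_ofFn_lt.2 hj') ?_ hk
    intro a ha
    obtain ⟨i, rfl⟩ := (List.mem_ofFn' _ _).1 ha
    exact h0 i

lemma IsGaussianState.wickDefect_eq_zero {N : ℕ} {ρ : FockOp N} (h : IsGaussianState ρ)
    (k : Fin (2 * N)) : wickDefect ρ k = 0 := by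
  refine eq_zero_of_trace_mul_listWord fun l hl => ?_
  obtain ⟨n, j, hj, rfl⟩ := exists_strictMono_of_pairwise hl
  rw [listWord_ofFn]
  exact h.word_mem_defectKernel n k j hj

/-! ### Quadratic and linear operators -/

/-- The even operators whose commutators with the Majorana operators are linear in these. -/
def quadraticSpace (N : ℕ) : Submodule ℂ (FockOp N) where
  carrier := {x | parity N * x * parity N = x ∧
    ∀ k, x * majorana k - majorana k * x ∈ linearSpan N}
  zero_mem' := ⟨by simp, fun k => by simp⟩
  add_mem' {x y} hx hy := by
    refine ⟨by rw [mul_add, add_mul, hx.1, hy.1], fun k => ?_⟩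
    rw [add_mul, mul_add, add_sub_add_comm]
    exact add_mem (hx.2 k) (hy.2 k)
  smul_mem' c x hx := by
    refine ⟨by rw [mul_smul_comm, smul_mul_assoc, hx.1], fun k => ?_⟩
    rw [mul_smul_comm, smul_mul_assoc, ← smul_sub]
    exact Submodule.smul_mem _ _ (hx.2 k)

lemma one_mem_quadraticSpace (N : ℕ) : 1 ∈ quadraticSpace N :=
  ⟨by rw [mul_one, parity_mul_parity], fun k => by simp⟩

lemma mul_mem_quadraticSpace {N : ℕ} {x y : FockOp N} (hx : x ∈ linearSpan N)
    (hy : y ∈ linearSpan N) : x * y ∈ quadraticSpace N := by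
  refine ⟨?_, fun k => ?_⟩
  · rw [parity_conj_mul, parity_conj_linear hx, parity_conj_linear hy, neg_mul_neg]
  · obtain ⟨a, ha⟩ := exists_anticomm_eq hx (majorana_mem_linearSpan k)
    obtain ⟨b, hb⟩ := exists_anticomm_eq hy (majorana_mem_linearSpan k)
    have h : x * y * majorana k - majorana k * (x * y) =
        x * (y * majorana k + majorana k * y) - (x * majorana k + majorana k * x) * y := by
      noncomm_ring
    rw [h, ha, hb, mul_smul_comm, mul_one, smul_mul_assoc, one_mul]
    exact sub_mem (Submodule.smul_mem _ _ hx) (Submodule.smul_mem _ _ hy)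

lemma IsQuadraticHamiltonian.mem_quadraticSpace {N : ℕ} {H : FockOp N}
    (hH : IsQuadraticHamiltonian H) : H ∈ quadraticSpace N := by
  obtain ⟨e, h, s, -, rfl⟩ := hH
  have ha := fun j : Fin N => annihilation_mem_linearSpan j
  have hc := fun j : Fin N => creation_mem_linearSpan j
  refine add_mem (add_mem (Submodule.smul_mem _ _ (one_mem_quadraticSpace N)) ?_) ?_
  · exact sum_mem fun j _ => sum_mem fun k _ =>
      Submodule.smul_mem _ _ (mul_mem_quadraticSpace (hc j) (ha k))
  · exact sum_mem fun j _ => sum_mem fun k _ => add_mem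
      (Submodule.smul_mem _ _ (mul_mem_quadraticSpace (hc j) (hc k)))
      (Submodule.smul_mem _ _ (mul_mem_quadraticSpace (ha k) (ha j)))

lemma IsQuadraticHamiltonian.isHermitian {N : ℕ} {H : FockOp N}
    (hH : IsQuadraticHamiltonian H) : Hᴴ = H := by
  obtain ⟨e, h, s, hh, rfl⟩ := hH
  have hca : ∀ j : Fin N, (creation j : FockOp N)ᴴ = annihilation j := fun j => by
    simp [creation]
  have hac : ∀ j : Fin N, (annihilation j : FockOp N)ᴴ = creation j := fun j => rfl
  simp only [Matrix.conjTranspose_add, Matrix.conjTranspose_sum, Matrix.conjTranspose_smul,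
    Matrix.conjTranspose_mul, hca, hac, Matrix.conjTranspose_one]
  congr 1
  · congr 1
    · simp
    · rw [Finset.sum_comm]
      refine Finset.sum_congr rfl fun j _ => Finset.sum_congr rfl fun k _ => ?_
      rw [hh.apply]
  · refine Finset.sum_congr rfl fun j _ => Finset.sum_congr rfl fun k _ => ?_
    rw [add_comm]
    simp

lemma IsLinearInModes.mem_linearSpan {N : ℕ} {L : FockOp N} (hL : IsLinearInModes L) :
    L ∈ linearSpan N := by
  obtain ⟨α, β, rfl⟩ := hL
  exact sum_mem fun j _ => add_mem (Submodule.smul_mem _ _ (creation_mem_linearSpan j))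
    (Submodule.smul_mem _ _ (annihilation_mem_linearSpan j))

lemma mul_sub_mul_mem_linearSpan {N : ℕ} {H v : FockOp N} (hH : H ∈ quadraticSpace N)
    (hv : v ∈ linearSpan N) : H * v - v * H ∈ linearSpan N := by
  obtain ⟨a, rfl⟩ := exists_coeff_of_mem_linearSpan hv
  rw [Finset.mul_sum, Finset.sum_mul, ← Finset.sum_sub_distrib]
  refine sum_mem fun k _ => ?_
  rw [mul_smul_comm, smul_mul_assoc, ← smul_sub]
  exact Submodule.smul_mem _ _ (hH.2 k)

/-! ### Moving linear operators through the Liouvillian -/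

/-- The dissipator of one Lindblad operator. -/
def dissipator {N : ℕ} (L ρ : FockOp N) : FockOp N :=
  (2 : ℂ) • (L * ρ * Lᴴ) - (Lᴴ * L * ρ + ρ * (Lᴴ * L))

/-- The dissipator with the opposite sign of the jump term, which governs odd operators. -/
def twistedDissipator {N : ℕ} (L ρ : FockOp N) : FockOp N :=
  -((2 : ℂ) • (L * ρ * Lᴴ)) - (Lᴴ * L * ρ + ρ * (Lᴴ * L))

lemma liouvillian_apply {N : ℕ} {ι : Type*} [Fintype ι] (H : FockOp N) (L : ι → FockOp N)
    (ρ : FockOp N) :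
    liouvillian H L ρ = -Complex.I • (H * ρ - ρ * H) + ∑ μ, dissipator (L μ) ρ := rfl

/-- The Liouvillian with the opposite sign of the jump terms. -/
def twistedLiouvillian {N : ℕ} {ι : Type*} [Fintype ι] (H : FockOp N) (L : ι → FockOp N) :
    FockOp N →ₗ[ℂ] FockOp N where
  toFun ρ := -Complex.I • (H * ρ - ρ * H) + ∑ μ, twistedDissipator (L μ) ρ
  map_add' ρ σ := by
    have key : ∀ μ, twistedDissipator (L μ) (ρ + σ) =
        twistedDissipator (L μ) ρ + twistedDissipator (L μ) σ := by
      intro μ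
      simp only [twistedDissipator, mul_add, add_mul, smul_add]
      abel
    simp only [key, Finset.sum_add_distrib, mul_add, add_mul, smul_sub, smul_add]
    abel
  map_smul' c ρ := by
    have key : ∀ μ, twistedDissipator (L μ) (c • ρ) = c • twistedDissipator (L μ) ρ := by
      intro μ
      simp only [twistedDissipator, Matrix.mul_smul, Matrix.smul_mul]
      module
    simp only [key, RingHom.id_apply, smul_add, Finset.smul_sum, smul_sub, Matrix.mul_smul,
      Matrix.smul_mul, smul_comm c]

lemma twistedLiouvillian_apply {N : ℕ} {ι : Type*} [Fintype ι] (H : FockOp N) (L : ι → FockOp N)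
    (ρ : FockOp N) : twistedLiouvillian H L ρ =
      -Complex.I • (H * ρ - ρ * H) + ∑ μ, twistedDissipator (L μ) ρ := rfl

/-- Passing c through a single L† flips the sign of the jump term, while passing it through the pair
L†L does not. The remainder 2γ Lρ is completed to an anticommutator with ρ, which leaves a one-sided
term ρx with the same x as in `trace_twistedDissipator_mul`. -/
lemma dissipator_mul {N : ℕ} {L c : FockOp N} {β γ : ℂ}
    (hβ : L * c + c * L = β • (1 : FockOp N)) (hγ : Lᴴ * c + c * Lᴴ = γ • (1 : FockOp N))
    (ρ : FockOp N) :
    dissipator L ρ * c = twistedDissipator L (ρ * c) + ρ * (-(γ • L + β • Lᴴ)) +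
      (ρ * ((2 * γ) • L) + ((2 * γ) • L) * ρ) := by
  have e1 : Lᴴ * c = γ • (1 : FockOp N) - c * Lᴴ := eq_sub_of_add_eq hγ
  have e2 : Lᴴ * (L * c) = β • Lᴴ - γ • L + c * (Lᴴ * L) := by
    rw [eq_sub_of_add_eq hβ, mul_sub, ← mul_assoc Lᴴ c, e1]
    simp only [sub_mul, smul_mul_assoc, mul_smul_comm, one_mul, mul_one, mul_assoc]
    abel
  unfold dissipator twistedDissipator
  simp only [sub_mul, add_mul, smul_mul_assoc, mul_assoc, e1, e2, mul_sub, mul_add,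
    mul_smul_comm, mul_one, mul_neg]
  module

lemma mul_dissipator {N : ℕ} {L c : FockOp N} {β γ : ℂ}
    (hβ : L * c + c * L = β • (1 : FockOp N)) (hγ : Lᴴ * c + c * Lᴴ = γ • (1 : FockOp N))
    (ρ : FockOp N) :
    c * dissipator L ρ = twistedDissipator L (c * ρ) + (2 * β) • (ρ * Lᴴ) +
      (β • Lᴴ - γ • L) * ρ := by
  have e1 : ∀ x, c * (L * x) = β • x - L * (c * x) := by
    intro x
    rw [← mul_assoc, eq_sub_of_add_eq' hβ, sub_mul, smul_mul_assoc, one_mul, mul_assoc]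
  have e2 : ∀ x, c * (Lᴴ * x) = γ • x - Lᴴ * (c * x) := by
    intro x
    rw [← mul_assoc, eq_sub_of_add_eq' hγ, sub_mul, smul_mul_assoc, one_mul, mul_assoc]
  unfold dissipator twistedDissipator
  simp only [sub_mul, smul_mul_assoc, mul_assoc, mul_sub, mul_add, mul_smul_comm, e1, e2]
  module

/-- In the sum of the left and right versions the one-sided remainders combine into a single
anticommutator with ρ. -/
lemma anticomm_dissipator {N : ℕ} {L c : FockOp N} {β γ : ℂ}
    (hβ : L * c + c * L = β • (1 : FockOp N)) (hγ : Lᴴ * c + c * Lᴴ = γ • (1 : FockOp N))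
    (ρ : FockOp N) :
    dissipator L ρ * c + c * dissipator L ρ = twistedDissipator L (ρ * c + c * ρ) +
      (ρ * (γ • L + β • Lᴴ) + (γ • L + β • Lᴴ) * ρ) := by
  have hadd : twistedDissipator L (ρ * c + c * ρ) =
      twistedDissipator L (ρ * c) + twistedDissipator L (c * ρ) := by
    simp only [twistedDissipator, mul_add, add_mul, smul_add]
    abel
  rw [dissipator_mul hβ hγ, mul_dissipator hβ hγ, hadd]
  simp only [mul_neg, mul_add, add_mul, sub_mul, mul_smul_comm, smul_mul_assoc]
  module

/-- The trace-dual of the twisted dissipator maps linear operators to linear ones, so orthogonality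
to linear operators is inherited by its images. -/
lemma trace_twistedDissipator_mul {N : ℕ} {L c : FockOp N} {β γ : ℂ}
    (hβ : L * c + c * L = β • (1 : FockOp N)) (hγ : Lᴴ * c + c * Lᴴ = γ • (1 : FockOp N))
    (y : FockOp N) :
    (twistedDissipator L y * c).trace = (y * (-(γ • L + β • Lᴴ))).trace := by
  have h : -(γ • L + β • Lᴴ) =
      -((2 : ℂ) • (Lᴴ * c * L)) - (c * (Lᴴ * L) + Lᴴ * L * c) := by
    have h1 : Lᴴ * (L * c + c * L) + (Lᴴ * c + c * Lᴴ) * L = γ • L + β • Lᴴ := by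
      rw [hβ, hγ, mul_smul_comm, mul_one, smul_mul_assoc, one_mul, add_comm]
    rw [← h1]
    simp only [mul_add, add_mul, mul_assoc]
    module
  rw [h]
  unfold twistedDissipator
  simp only [sub_mul, add_mul, mul_sub, mul_add, neg_mul, mul_neg, smul_mul_assoc, mul_smul_comm,
    Matrix.trace_sub, Matrix.trace_add, Matrix.trace_neg, Matrix.trace_smul]
  have t1 : (L * y * Lᴴ * c).trace = (y * (Lᴴ * c * L)).trace := by
    rw [mul_assoc, mul_assoc, Matrix.trace_mul_comm]; simp only [mul_assoc]
  have t2 : (Lᴴ * L * y * c).trace = (y * (c * (Lᴴ * L))).trace := by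
    rw [mul_assoc, Matrix.trace_mul_comm]; simp only [mul_assoc]
  rw [t1, t2, mul_assoc y (Lᴴ * L) c]

section

variable {N : ℕ} {ι : Type*} [Fintype ι] {H : FockOp N} {L : ι → FockOp N}

/-- Multiplication by a linear operator intertwines the Liouvillian and its twisted form up to
terms linear in the Majorana operators. -/
lemma exists_liouvillian_mul (hH : H ∈ quadraticSpace N) (hL : ∀ μ, L μ ∈ linearSpan N)
    {c : FockOp N} (hc : c ∈ linearSpan N) :
    ∃ x ∈ linearSpan N, ∃ z ∈ linearSpan N,
      (∀ ρ, liouvillian H L ρ * c =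
        twistedLiouvillian H L (ρ * c) + ρ * x + (ρ * z + z * ρ)) ∧
      ∀ y, (twistedLiouvillian H L y * c).trace = (y * x).trace := by
  choose β hβ using fun μ => exists_anticomm_eq (hL μ) hc
  choose γ hγ using fun μ => exists_anticomm_eq (conjTranspose_mem_linearSpan (hL μ)) hc
  refine ⟨Complex.I • (H * c - c * H) + ∑ μ, -(γ μ • L μ + β μ • (L μ)ᴴ), ?_,
    ∑ μ, (2 * γ μ) • L μ, ?_, fun ρ => ?_, fun y => ?_⟩
  · refine add_mem (Submodule.smul_mem _ _ (mul_sub_mul_mem_linearSpan hH hc))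
      (sum_mem fun μ _ => neg_mem (add_mem (Submodule.smul_mem _ _ (hL μ))
        (Submodule.smul_mem _ _ (conjTranspose_mem_linearSpan (hL μ)))))
  · exact sum_mem fun μ _ => Submodule.smul_mem _ _ (hL μ)
  · rw [liouvillian_apply, twistedLiouvillian_apply, add_mul, Finset.sum_mul,
      Finset.sum_congr rfl fun μ _ => dissipator_mul (hβ μ) (hγ μ) ρ]
    simp only [Finset.sum_add_distrib, mul_add, Finset.mul_sum, Finset.sum_mul, smul_mul_assoc,
      mul_smul_comm, sub_mul, mul_sub, smul_sub, mul_assoc]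
    module
  · rw [twistedLiouvillian_apply, add_mul, Finset.sum_mul, Matrix.trace_add, Matrix.trace_sum,
      Finset.sum_congr rfl fun μ _ => trace_twistedDissipator_mul (hβ μ) (hγ μ) y, mul_add,
      Matrix.trace_add, Finset.mul_sum, Matrix.trace_sum]
    congr 1
    simp only [smul_mul_assoc, mul_smul_comm, Matrix.trace_smul, sub_mul, mul_sub,
      Matrix.trace_sub, smul_eq_mul, mul_assoc]
    rw [Matrix.trace_mul_comm H, mul_assoc]
    ring

lemma exists_anticomm_liouvillian (hH : H ∈ quadraticSpace N) (hL : ∀ μ, L μ ∈ linearSpan N)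
    {c : FockOp N} (hc : c ∈ linearSpan N) :
    ∃ y ∈ linearSpan N, ∀ ρ, liouvillian H L ρ * c + c * liouvillian H L ρ =
        twistedLiouvillian H L (ρ * c + c * ρ) + (ρ * y + y * ρ) := by
  choose β hβ using fun μ => exists_anticomm_eq (hL μ) hc
  choose γ hγ using fun μ => exists_anticomm_eq (conjTranspose_mem_linearSpan (hL μ)) hc
  refine ⟨Complex.I • (H * c - c * H) + ∑ μ, (γ μ • L μ + β μ • (L μ)ᴴ), ?_, fun ρ => ?_⟩
  · refine add_mem (Submodule.smul_mem _ _ (mul_sub_mul_mem_linearSpan hH hc))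
      (sum_mem fun μ _ => (add_mem (Submodule.smul_mem _ _ (hL μ))
        (Submodule.smul_mem _ _ (conjTranspose_mem_linearSpan (hL μ)))))
  · have hs : (∑ μ, dissipator (L μ) ρ) * c + c * ∑ μ, dissipator (L μ) ρ =
        ∑ μ, twistedDissipator (L μ) (ρ * c + c * ρ) +
          (ρ * ∑ μ, (γ μ • L μ + β μ • (L μ)ᴴ) + (∑ μ, (γ μ • L μ + β μ • (L μ)ᴴ)) * ρ) := by
      simp only [Finset.mul_sum, Finset.sum_mul, ← Finset.sum_add_distrib]
      exact Finset.sum_congr rfl fun μ _ => anticomm_dissipator (hβ μ) (hγ μ) ρ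
    rw [liouvillian_apply, twistedLiouvillian_apply, add_mul, mul_add, add_add_add_comm, hs]
    simp only [mul_add, add_mul, smul_mul_assoc,
      mul_smul_comm, sub_mul, mul_sub, mul_assoc]
    module

lemma trace_liouvillian (ρ : FockOp N) : (liouvillian H L ρ).trace = 0 := by
  rw [liouvillian_apply, Matrix.trace_add, Matrix.trace_smul, Matrix.trace_sub,
    Matrix.trace_mul_comm H, sub_self, smul_zero, zero_add, Matrix.trace_sum]
  refine Finset.sum_eq_zero fun μ _ => ?_
  unfold dissipator
  rw [Matrix.trace_sub, Matrix.trace_add, Matrix.trace_smul, Matrix.trace_mul_comm (L μ * ρ),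
    ← mul_assoc, Matrix.trace_mul_comm ρ, smul_eq_mul]
  ring

lemma parity_conj_liouvillian (hH : H ∈ quadraticSpace N) (hL : ∀ μ, L μ ∈ linearSpan N)
    (ρ : FockOp N) : parity N * liouvillian H L ρ * parity N =
      liouvillian H L (parity N * ρ * parity N) := by
  simp only [liouvillian_apply, dissipator, mul_add, add_mul, mul_sub, sub_mul, Finset.mul_sum,
    Finset.sum_mul, mul_smul_comm, smul_mul_assoc]
  simp only [parity_conj_mul, hH.1, parity_conj_linear (hL _),
    parity_conj_linear (conjTranspose_mem_linearSpan (hL _)), neg_mul, mul_neg, neg_neg]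

end

/-! ### The linear equation satisfied by the defects -/

lemma meanField_trace_mul {N : ℕ} (ρ : FockOp N) (j l : Fin (2 * N)) (σ : FockOp N) :
    ((σ * meanField ρ j + meanField ρ j * σ) * majorana l).trace = twoPoint ρ j l * σ.trace := by
  have h : ((σ * meanField ρ j + meanField ρ j * σ) * majorana l).trace =
      (σ * (meanField ρ j * majorana l + majorana l * meanField ρ j)).trace := by
    rw [add_mul, mul_add, Matrix.trace_add, Matrix.trace_add, mul_assoc (meanField ρ j),
      Matrix.trace_mul_comm (meanField ρ j), mul_assoc, mul_assoc]
  rw [h, meanField_anticomm, mul_smul_comm, mul_one, Matrix.trace_smul, smul_eq_mul]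

/-- Here only the trace of ρ matters: g_j is built to reproduce the two-point function, whether or
not ρ is Gaussian. -/
lemma trace_wickDefect_mul_majorana {N : ℕ} {ρ : FockOp N} (h1 : ρ.trace = 1)
    (j l : Fin (2 * N)) : (wickDefect ρ j * majorana l).trace = 0 := by
  unfold wickDefect
  rw [sub_mul, Matrix.trace_sub, meanField_trace_mul, h1, mul_one, mul_assoc]
  exact sub_self _

/-- By cyclicity the trace is tr(ρ {u, c_l}), which is twice the l-th coefficient of u. -/
lemma eq_zero_of_trace_anticomm {N : ℕ} {ρ u : FockOp N} (h1 : ρ.trace = 1)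
    (hu : u ∈ linearSpan N) (h : ∀ l, ((ρ * u + u * ρ) * majorana l).trace = 0) : u = 0 := by
  obtain ⟨a, rfl⟩ := exists_coeff_of_mem_linearSpan hu
  refine Finset.sum_eq_zero fun l _ => ?_
  have hl := h l
  have h2 : ((ρ * (∑ k, a k • majorana k) + (∑ k, a k • majorana k) * ρ) * majorana l).trace =
      (ρ * ((∑ k, a k • majorana k) * majorana l +
        majorana l * ∑ k, a k • majorana k)).trace := by
    rw [add_mul, mul_add, Matrix.trace_add, Matrix.trace_add,
      mul_assoc (∑ k, a k • majorana k) ρ,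
      Matrix.trace_mul_comm (∑ k, a k • majorana k) (ρ * majorana l), mul_assoc, mul_assoc]
  have h3 : (∑ k, a k • majorana k) * majorana l + majorana l * ∑ k, a k • majorana k =
      (a l * 2) • (1 : FockOp N) := by
    rw [Finset.sum_mul, Finset.mul_sum, ← Finset.sum_add_distrib]
    simp only [smul_mul_assoc, mul_smul_comm, ← smul_add, majorana_anticomm]
    rw [Finset.sum_eq_single l (by intro b _ hb; simp [hb]) (by simp), if_pos rfl, smul_smul]
  rw [h2, h3, mul_smul_comm, mul_one, Matrix.trace_smul, h1, smul_eq_mul, mul_one] at hl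
  have : a l = 0 := by simpa using hl
  rw [this, zero_smul]

/-- The first-order variation of the defect in the direction `σ`. -/
def wickDefectVariation {N : ℕ} (ρ σ : FockOp N) (j : Fin (2 * N)) : FockOp N :=
  σ * majorana j - (σ * meanField ρ j + meanField ρ j * σ) -
    (ρ * meanField σ j + meanField σ j * ρ)

/-- The coefficients X are chosen before ρ. This makes the resulting equation linear with constant
coefficients although the defect is quadratic in ρ. -/
lemma exists_wickDefectVariation_eq {N : ℕ} {ι : Type*} [Fintype ι] {H : FockOp N}
    {L : ι → FockOp N} (hH : H ∈ quadraticSpace N) (hL : ∀ μ, L μ ∈ linearSpan N)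
    (j : Fin (2 * N)) : ∃ X : Fin (2 * N) → ℂ, ∀ ρ : FockOp N, ρ.trace = 1 →
      wickDefectVariation ρ (liouvillian H L ρ) j =
        twistedLiouvillian H L (wickDefect ρ j) + ∑ k, X k • wickDefect ρ k := by
  obtain ⟨x, hx, z, hz, hmul, htr⟩ := exists_liouvillian_mul hH hL (majorana_mem_linearSpan j)
  obtain ⟨X, rfl⟩ := exists_coeff_of_mem_linearSpan hx
  refine ⟨X, fun ρ h1 => ?_⟩
  obtain ⟨y, hy, hanti⟩ := exists_anticomm_liouvillian hH hL (meanField_mem ρ j)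
  set σ := liouvillian H L ρ with hσ
  -- u collects every remainder that occurs in an anticommutator with ρ, including those left when ρ
  -- c_k is rewritten as the defect plus {ρ, g_k}.
  set u := z - y - meanField σ j + ∑ k, X k • meanField ρ k with hu
  have hum : u ∈ linearSpan N := add_mem (sub_mem (sub_mem hz hy) (meanField_mem σ j))
    (sum_mem fun k _ => Submodule.smul_mem _ _ (meanField_mem ρ k))
  have hX : ρ * ∑ k, X k • majorana k = ∑ k, X k • wickDefect ρ k +
      (ρ * (∑ k, X k • meanField ρ k) + (∑ k, X k • meanField ρ k) * ρ) := by
    simp only [Finset.mul_sum, Finset.sum_mul, ← Finset.sum_add_distrib]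
    refine Finset.sum_congr rfl fun k _ => ?_
    unfold wickDefect
    simp only [mul_smul_comm, smul_mul_assoc]
    module
  have hvar : wickDefectVariation ρ σ j = twistedLiouvillian H L (wickDefect ρ j) +
      ∑ k, X k • wickDefect ρ k + (ρ * u + u * ρ) := by
    unfold wickDefectVariation
    rw [hmul, hanti, hX, hu]
    have : twistedLiouvillian H L (wickDefect ρ j) = twistedLiouvillian H L (ρ * majorana j) -
      twistedLiouvillian H L (ρ * meanField ρ j + meanField ρ j * ρ) := by
      rw [← map_sub]; rfl
    rw [this]
    simp only [mul_add, mul_sub, add_mul, sub_mul]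
    abel
  -- Every term other than {ρ, u} is orthogonal to the Majorana operators; for the variation this
  -- uses tr ρ = 1 and tr ℒ(ρ) = 0. Hence {ρ, u} is orthogonal to them as well, which forces u = 0.
  have hu0 : u = 0 := by
    refine eq_zero_of_trace_anticomm h1 hum fun l => ?_
    have hv : (wickDefectVariation ρ σ j * majorana l).trace = 0 := by
      unfold wickDefectVariation
      rw [sub_mul, sub_mul, Matrix.trace_sub, Matrix.trace_sub, meanField_trace_mul,
        meanField_trace_mul, h1, trace_liouvillian, mul_assoc]
      change twoPoint σ j l - _ - _ = 0
      ring
    have hE : ∀ v ∈ linearSpan N, ∀ k, (wickDefect ρ k * v).trace = 0 := by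
      intro v hv k
      obtain ⟨a, rfl⟩ := exists_coeff_of_mem_linearSpan hv
      rw [Finset.mul_sum, Matrix.trace_sum]
      refine Finset.sum_eq_zero fun i _ => ?_
      rw [mul_smul_comm, Matrix.trace_smul, trace_wickDefect_mul_majorana h1, smul_zero]
    obtain ⟨x', hx', -, -, -, htr'⟩ := exists_liouvillian_mul hH hL (majorana_mem_linearSpan l)
    rw [hvar, add_mul, add_mul, Matrix.trace_add, Matrix.trace_add, htr', hE x' hx',
      Finset.sum_mul, Matrix.trace_sum, Finset.sum_eq_zero, zero_add, zero_add] at hv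
    · exact hv
    · intro k _
      rw [smul_mul_assoc, Matrix.trace_smul, trace_wickDefect_mul_majorana h1, smul_zero]
  rw [hvar, hu0]
  simp

/-! ### Differential equations along the time evolution -/

section

open scoped Matrix.Norms.L2Operator

/-- Uniqueness of the zero solution of a linear differential equation. -/
lemma eq_zero_of_hasDerivAt_linear {V : Type*} [NormedAddCommGroup V] [NormedSpace ℝ V]
    [FiniteDimensional ℝ V] (A : V →ₗ[ℝ] V) (f : ℝ → V) (h0 : f 0 = 0)
    (hf : ∀ t, HasDerivAt f (A (f t)) t) (t : ℝ) : f t = 0 := by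
  have h := ODE_solution_unique_univ (v := fun _ => LinearMap.toContinuousLinearMap A)
    (s := fun _ => Set.univ) (f := f) (g := fun _ => 0) (t₀ := 0)
    (K := ‖LinearMap.toContinuousLinearMap A‖₊)
    (fun _ => (LinearMap.toContinuousLinearMap A).lipschitz.lipschitzOnWith)
    (fun t => ⟨hf t, trivial⟩)
    (fun t => ⟨by simpa using hasDerivAt_const t (0 : V), trivial⟩) h0
  exact congrFun h t

variable {N : ℕ}

lemma timeEvolution_zero (ℒ : FockOp N →ₗ[ℂ] FockOp N) (ρ : FockOp N) :
    timeEvolution ℒ 0 ρ = ρ := by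
  unfold timeEvolution
  have h : ((0 : ℝ) : ℂ) • LinearMap.toContinuousLinearMap ℒ = 0 := by
    rw [Complex.ofReal_zero]; exact zero_smul ℂ (LinearMap.toContinuousLinearMap ℒ)
  rw [h, NormedSpace.exp_zero]
  rfl

lemma hasDerivAt_timeEvolution (ℒ : FockOp N →ₗ[ℂ] FockOp N) (ρ : FockOp N) (t : ℝ) :
    HasDerivAt (fun t => timeEvolution ℒ t ρ) (ℒ (timeEvolution ℒ t ρ)) t := by
  have h := hasDerivAt_exp_smul_const' (𝕂 := ℝ) (LinearMap.toContinuousLinearMap ℒ) t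
  have h2 := ((ContinuousLinearMap.apply ℂ (FockOp N) ρ).restrictScalars ℝ).hasFDerivAt.comp_hasDerivAt t h
  exact h2

lemma hasDerivAt_linear_comp {V W : Type*} [NormedAddCommGroup V] [NormedSpace ℝ V]
    [FiniteDimensional ℝ V] [NormedAddCommGroup W] [NormedSpace ℝ W] (A : V →ₗ[ℝ] W)
    {f : ℝ → V} {f' : V} {t : ℝ} (hf : HasDerivAt f f' t) :
    HasDerivAt (fun t => A (f t)) (A f') t :=
  (LinearMap.toContinuousLinearMap A).hasFDerivAt.comp_hasDerivAt t hf

variable {ι : Type*} [Fintype ι] {H : FockOp N} {L : ι → FockOp N}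

lemma trace_timeEvolution (ρ : FockOp N) (t : ℝ) :
    (timeEvolution (liouvillian H L) t ρ).trace = ρ.trace := by
  have hd : ∀ s, HasDerivAt (fun s => (timeEvolution (liouvillian H L) s ρ).trace) 0 s := by
    intro s
    have h := hasDerivAt_linear_comp ((Matrix.traceLinearMap (Finset (Fin N)) ℂ ℂ).restrictScalars ℝ)
      (hasDerivAt_timeEvolution (liouvillian H L) ρ s)
    simpa [trace_liouvillian] using h
  have h := is_const_of_deriv_eq_zero (fun s => (hd s).differentiableAt)
    (fun s => (hd s).deriv) t 0
  rwa [timeEvolution_zero] at h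

lemma parity_conj_timeEvolution (hH : H ∈ quadraticSpace N) (hL : ∀ μ, L μ ∈ linearSpan N)
    {ρ : FockOp N} (hρ : parity N * ρ * parity N = ρ) (t : ℝ) :
    parity N * timeEvolution (liouvillian H L) t ρ * parity N =
      timeEvolution (liouvillian H L) t ρ := by
  rw [← sub_eq_zero]
  let C : FockOp N →ₗ[ℝ] FockOp N :=
    ((LinearMap.mulRight ℂ (parity N)).comp (LinearMap.mulLeft ℂ (parity N)) -
      LinearMap.id).restrictScalars ℝ
  have hC : ∀ x, C x = parity N * x * parity N - x := fun x => rfl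
  refine eq_zero_of_hasDerivAt_linear ((liouvillian H L).restrictScalars ℝ)
    (fun t => C (timeEvolution (liouvillian H L) t ρ)) ?_ (fun s => ?_) t
  · simp only [timeEvolution_zero, hC, hρ, sub_self]
  · have h := hasDerivAt_linear_comp C (hasDerivAt_timeEvolution (liouvillian H L) ρ s)
    rw [hC, parity_conj_liouvillian hH hL, ← map_sub] at h
    exact h

lemma meanField_hasDerivAt {r : ℝ → FockOp N} {σ : FockOp N} {t : ℝ} (hr : HasDerivAt r σ t)
    (j : Fin (2 * N)) : HasDerivAt (fun t => meanField (r t) j) (meanField σ j) t := by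
  unfold meanField
  refine HasDerivAt.fun_sum fun k _ => ?_
  have h := hasDerivAt_linear_comp (((Matrix.traceLinearMap (Finset (Fin N)) ℂ ℂ).comp
    (LinearMap.mulRight ℂ (majorana j * majorana k))).restrictScalars ℝ) hr
  exact (h.div_const 2).smul_const (majorana k)

lemma wickDefect_hasDerivAt {r : ℝ → FockOp N} {σ : FockOp N} {t : ℝ} (hr : HasDerivAt r σ t)
    (j : Fin (2 * N)) :
    HasDerivAt (fun t => wickDefect (r t) j) (wickDefectVariation (r t) σ j) t := by
  have hg := meanField_hasDerivAt hr j
  have h := (hr.mul_const (majorana j)).sub ((hr.mul hg).add (hg.mul hr))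
  refine h.congr_deriv ?_
  unfold wickDefectVariation
  abel

lemma wickDefect_timeEvolution (hH : H ∈ quadraticSpace N) (hL : ∀ μ, L μ ∈ linearSpan N)
    {ρ : FockOp N} (h1 : ρ.trace = 1) (hE : ∀ j, wickDefect ρ j = 0) (t : ℝ) (j : Fin (2 * N)) :
    wickDefect (timeEvolution (liouvillian H L) t ρ) j = 0 := by
  choose X hX using fun j => exists_wickDefectVariation_eq hH hL j
  let A : (Fin (2 * N) → FockOp N) →ₗ[ℝ] (Fin (2 * N) → FockOp N) := LinearMap.pi fun j =>
    ((twistedLiouvillian H L).comp (LinearMap.proj j) +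
      ∑ k, X j k • LinearMap.proj k).restrictScalars ℝ
  have hA : ∀ F j, A F j = twistedLiouvillian H L (F j) + ∑ k, X j k • F k := by
    intro F j
    simp [A, LinearMap.sum_apply]
  have h := eq_zero_of_hasDerivAt_linear A
    (fun t => wickDefect (timeEvolution (liouvillian H L) t ρ)) (by
      funext j
      rw [timeEvolution_zero, hE]
      rfl) (fun s => by
      rw [hasDerivAt_pi]
      intro j
      rw [hA, ← hX j _ (by rw [trace_timeEvolution, h1])]
      exact wickDefect_hasDerivAt (hasDerivAt_timeEvolution _ _ _) j) t
  exact congrFun h j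

/-! ### Preservation of positivity -/

lemma isClosed_posSemidef : IsClosed {x : FockOp N | x.PosSemidef} := by
  have h : {x : FockOp N | x.PosSemidef} = {x | xᴴ = x} ∩
      ⋂ v : Finset (Fin N) → ℂ, {x | 0 ≤ star v ⬝ᵥ x *ᵥ v} := by
    ext x
    simp only [Matrix.posSemidef_iff_dotProduct_mulVec, Set.mem_inter_iff, Set.mem_iInter]
    rfl
  rw [h]
  refine (isClosed_eq continuous_id.matrix_conjTranspose continuous_id).inter
    (isClosed_iInter fun v => ?_)
  refine isClosed_le continuous_const ?_
  exact continuous_const.dotProduct (continuous_id.matrix_mulVec continuous_const)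

lemma posSemidef_smul {x : FockOp N} (hx : x.PosSemidef) {r : ℝ} (hr : 0 ≤ r) :
    ((r : ℂ) • x).PosSemidef := hx.smul (by exact_mod_cast hr)

/-- The exponential of a positive map is positive. -/
lemma posSemidef_exp_apply (A : FockOp N →L[ℂ] FockOp N)
    (hA : ∀ x : FockOp N, x.PosSemidef → (A x).PosSemidef) {x : FockOp N} (hx : x.PosSemidef) :
    (NormedSpace.exp A x).PosSemidef := by
  have h := NormedSpace.exp_series_hasSum_exp' (𝕂 := ℝ) A
  have h2 := h.mapL ((ContinuousLinearMap.apply ℂ (FockOp N) x).restrictScalars ℝ)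
  refine isClosed_posSemidef.mem_of_tendsto h2 (Filter.Eventually.of_forall fun s => ?_)
  refine Matrix.posSemidef_sum _ fun n _ => ?_
  have hpow : ∀ n : ℕ, ((A ^ n) x).PosSemidef := by
    intro n
    induction n with
    | zero => simpa using hx
    | succ n ih => rw [pow_succ']; exact hA _ ih
  have := posSemidef_smul (hpow n) (r := (n.factorial : ℝ)⁻¹) (by positivity)
  exact this

end

/-- The exponential of an element shifted by a scalar. -/
lemma exp_algebraMap_add {𝔸 : Type*} [NormedRing 𝔸] [NormedAlgebra ℝ 𝔸] [CompleteSpace 𝔸]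
    (r : ℝ) (B : 𝔸) :
    NormedSpace.exp (algebraMap ℝ 𝔸 r + B) = Real.exp r • NormedSpace.exp B := by
  let _ : NormedAlgebra ℚ 𝔸 := NormedAlgebra.restrictScalars ℚ ℝ 𝔸
  rw [NormedSpace.exp_add_of_commute (Algebra.commutes _ _), ← NormedSpace.algebraMap_exp_comm,
    Algebra.algebraMap_eq_smul_one, smul_one_mul, ← Real.exp_eq_exp_ℝ]

lemma tendsto_exp_comp {𝔸 : Type*} [NormedRing 𝔸] [NormedAlgebra ℝ 𝔸] [CompleteSpace 𝔸]
    {f : ℕ → 𝔸} {a : 𝔸} (h : Filter.Tendsto f Filter.atTop (nhds a)) :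
    Filter.Tendsto (fun n => NormedSpace.exp (f n)) Filter.atTop (nhds (NormedSpace.exp a)) := by
  let _ : NormedAlgebra ℚ 𝔸 := NormedAlgebra.restrictScalars ℚ ℝ 𝔸
  exact (NormedSpace.exp_continuous.tendsto a).comp h

section

open scoped Matrix.Norms.L2Operator

variable {N : ℕ} {ι : Type*} [Fintype ι] {H : FockOp N} {L : ι → FockOp N}

/-- The non-Hermitian generator `-iH - ∑_μ L_μ† L_μ` of the evolution without jumps. -/
def noJumpGenerator (H : FockOp N) (L : ι → FockOp N) : FockOp N :=
  -Complex.I • H - ∑ μ, (L μ)ᴴ * L μ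

lemma conjTranspose_noJumpGenerator (hH : Hᴴ = H) :
    (noJumpGenerator H L)ᴴ = Complex.I • H - ∑ μ, (L μ)ᴴ * L μ := by
  simp [noJumpGenerator, Matrix.conjTranspose_sum, hH, Matrix.conjTranspose_smul]

lemma liouvillian_eq_noJump (hH : Hᴴ = H) (x : FockOp N) : liouvillian H L x =
    noJumpGenerator H L * x + x * (noJumpGenerator H L)ᴴ +
      ∑ μ, (2 : ℂ) • (L μ * x * (L μ)ᴴ) := by
  rw [liouvillian_apply, conjTranspose_noJumpGenerator hH, noJumpGenerator]
  simp only [dissipator, Finset.sum_sub_distrib, Finset.sum_add_distrib, sub_mul, mul_sub,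
    Finset.sum_mul, Finset.mul_sum, smul_mul_assoc, mul_smul_comm]
  module

/-- A shift of the Liouvillian is a positive map, up to the correction `c⁻¹ K x K†`. -/
lemma posSemidef_shifted_liouvillian (hH : Hᴴ = H) {c : ℝ} (hc : 0 < c) {x : FockOp N}
    (hx : x.PosSemidef) : (liouvillian H L x +
      (c : ℂ)⁻¹ • (noJumpGenerator H L * x * (noJumpGenerator H L)ᴴ) + (c : ℂ) • x).PosSemidef := by
  set K := noJumpGenerator H L with hK
  have hc' : (c : ℂ) ≠ 0 := by exact_mod_cast hc.ne'
  -- Completing the square: c⁻¹ (c + K) x (c + K)† = c x + K x + x K† + c⁻¹ K x K†.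
  have h : liouvillian H L x + (c : ℂ)⁻¹ • (K * x * Kᴴ) + (c : ℂ) • x =
      (c : ℂ)⁻¹ • (((c : ℂ) • 1 + K) * x * ((c : ℂ) • 1 + K)ᴴ) +
        ∑ μ, (2 : ℂ) • (L μ * x * (L μ)ᴴ) := by
    rw [liouvillian_eq_noJump hH, ← hK]
    simp only [Matrix.conjTranspose_add, Matrix.conjTranspose_smul, Matrix.conjTranspose_one,
      Complex.star_def, Complex.conj_ofReal, add_mul, mul_add, smul_mul_assoc, mul_smul_comm,
      one_mul, mul_one, smul_add, smul_smul, inv_mul_cancel₀ hc', one_smul]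
    rw [inv_mul_cancel_left₀ hc']
    abel
  rw [h]
  refine Matrix.PosSemidef.add ?_ (Matrix.posSemidef_sum _ fun μ _ => ?_)
  · have := posSemidef_smul (hx.mul_mul_conjTranspose_same ((c : ℂ) • 1 + K)) (inv_nonneg.2 hc.le)
    rwa [Complex.ofReal_inv] at this
  · have := posSemidef_smul (hx.mul_mul_conjTranspose_same (L μ)) (zero_le_two (α := ℝ))
    simpa using this

/-- The Lindblad evolution preserves positivity. -/
theorem posSemidef_timeEvolution (hH : Hᴴ = H) {ρ : FockOp N} (hρ : ρ.PosSemidef) {t : ℝ}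
    (ht : 0 ≤ t) : (timeEvolution (liouvillian H L) t ρ).PosSemidef := by
  set K := noJumpGenerator H L with hK
  let A : FockOp N →L[ℂ] FockOp N := LinearMap.toContinuousLinearMap (liouvillian H L)
  let Q : FockOp N →L[ℂ] FockOp N := LinearMap.toContinuousLinearMap
    ((LinearMap.mulRight ℂ Kᴴ).comp (LinearMap.mulLeft ℂ K))
  -- The shift by c, which makes the generator a positive map, commutes with everything and is
  -- undone by the positive factor exp(-tc).
  have hpos : ∀ c : ℝ, 0 < c →
      (NormedSpace.exp ((t : ℂ) • (A + (c : ℂ)⁻¹ • Q)) ρ).PosSemidef := by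
    intro c hc
    let B : FockOp N →L[ℂ] FockOp N := (t : ℂ) • (A + (c : ℂ)⁻¹ • Q + (c : ℂ) • 1)
    have hB : ∀ x : FockOp N, x.PosSemidef → (B x).PosSemidef := fun x hx =>
      posSemidef_smul (posSemidef_shifted_liouvillian hH hc hx) ht
    have hsplit : (t : ℂ) • (A + (c : ℂ)⁻¹ • Q) =
        algebraMap ℝ (FockOp N →L[ℂ] FockOp N) (-(t * c)) + B := by
      rw [Algebra.algebraMap_eq_smul_one]
      ext1 x
      change (t : ℂ) • (A x + (c : ℂ)⁻¹ • Q x) = (-(t * c)) • x +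
        (t : ℂ) • (A x + (c : ℂ)⁻¹ • Q x + (c : ℂ) • x)
      rw [← Complex.coe_smul]
      push_cast
      module
    rw [hsplit]
    refine (congrArg (fun T : FockOp N →L[ℂ] FockOp N => (T ρ).PosSemidef)
      (exp_algebraMap_add (-(t * c)) B)).mpr ?_
    exact posSemidef_smul (posSemidef_exp_apply B hB hρ) (Real.exp_pos _).le
  -- With c = n + 1 → ∞ the correction c⁻¹ Q disappears, and the positive semidefinite cone is
  -- closed.
  have hlim : Filter.Tendsto (fun n : ℕ => NormedSpace.exp
      ((t : ℂ) • (A + (((n : ℝ) + 1 : ℝ) : ℂ)⁻¹ • Q)) ρ) Filter.atTop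
      (nhds (NormedSpace.exp ((t : ℂ) • A) ρ)) := by
    have h1 : Filter.Tendsto (fun n : ℕ => (((n : ℝ) + 1 : ℝ) : ℂ)⁻¹) Filter.atTop (nhds 0) := by
      have := (Complex.continuous_ofReal.tendsto 0).comp
        (tendsto_one_div_add_atTop_nhds_zero_nat (𝕜 := ℝ))
      simpa [Function.comp_def] using this
    have h2 : Filter.Tendsto (fun n : ℕ => (t : ℂ) • (A + (((n : ℝ) + 1 : ℝ) : ℂ)⁻¹ • Q))
        Filter.atTop (nhds ((t : ℂ) • A)) := by
      have h0 : A + (0 : ℂ) • Q = A := by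
        rw [show (0 : ℂ) • Q = 0 from zero_smul ℂ Q]
        exact add_zero A
      have h := ((h1.smul_const Q).const_add A).const_smul (t : ℂ)
      exact (congrArg (fun T => Filter.Tendsto _ Filter.atTop (nhds ((t : ℂ) • T))) h0).mp h
    have h3 := tendsto_exp_comp (𝔸 := FockOp N →L[ℂ] FockOp N) h2
    exact ((ContinuousLinearMap.apply ℂ (FockOp N) ρ).continuous.tendsto _).comp h3
  exact isClosed_posSemidef.mem_of_tendsto hlim
    (Filter.Eventually.of_forall fun n => hpos _ (by positivity))

end

end

end FermionicGaussian


theorem lemma1 {N : ℕ} {ι : Type*} [Fintype ι]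
    (H : FermionicGaussian.FockOp N) (hH : FermionicGaussian.IsQuadraticHamiltonian H)
    (L : ι → FermionicGaussian.FockOp N) (hL : ∀ μ, FermionicGaussian.IsLinearInModes (L μ))
    (ρ : FermionicGaussian.FockOp N) (hρ : FermionicGaussian.IsGaussianState ρ)
    (t : ℝ) (ht : 0 ≤ t) :
    FermionicGaussian.IsGaussianState
      (FermionicGaussian.timeEvolution (FermionicGaussian.liouvillian H L) t ρ) := by
  have hHq := hH.mem_quadraticSpace
  have hLl := fun μ => (hL μ).mem_linearSpan
  refine FermionicGaussian.isGaussianState_of_wickDefect ⟨?_, ?_⟩ ?_ ?_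
  · exact FermionicGaussian.posSemidef_timeEvolution hH.isHermitian hρ.isState.1 ht
  · rw [FermionicGaussian.trace_timeEvolution, hρ.isState.2]
  · exact FermionicGaussian.parity_conj_timeEvolution hHq hLl hρ.parity_conj t
  · exact FermionicGaussian.wickDefect_timeEvolution hHq hLl hρ.isState.2
      hρ.wickDefect_eq_zero t
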